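/- **Theorem.** Let $a:[0,\infty)\to[0,\infty)$ be differentiable and non-increasing with $\lim_{t\to\infty}a(t)=0$, and assume that there is $c>0$ with $a(t)\ge \frac{c}{t+1}$ for all $t\ge 0$. Let $G:\mathbb{R}\to\mathbb{R}$ be of class $\mathcal{C}^1$ and coercive ($G(\xi)\to\infty$ as $|\xi|\to\infty$), with $G'$ Lipschitz continuous on bounded sets. Assume moreover: (a) $G$ has finitely many critical points; (b) $G$ takes different values at different critical points; (c) near each critical point $x^*$, $G$ is either strongly convex or strongly concave. Here $G$ is strongly convex near $x^*$ if there are $\varepsilon,\delta>0$ such that $G(y)\ge G(x)+(y-x)G'(x)+\delta(y-x)^2$ for all $x,y\in(x^*-\varepsilon,x^*+\varepsilon)$, and strongly concave near $x^*$ if $-G$ is strongly convex near $x^*$. Then for every $(x_0,x_1)\in\mathbb{R}^2$ the problem $$\ddot x(t)+a(t)\,\dot x(t)+G'(x(t))=0\quad (t\ge 0),\qquad x(0)=x_0,\quad \dot x(0)=x_1,$$ has a unique solution $x\in\mathcal{C}^2([0,\infty))$, and the set of initial data $(x_0,x_1)\in\mathbb{R}^2$ for which $\lim_{t\to\infty}x(t)$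 exists and is a local minimum point of $G$ is open and dense in $\mathbb{R}^2$. -/

import Mathlib

open Set Filter Topology

/-- `G` is strongly convex in the neighbourhood of `c`: for some `ε, δ > 0`,
`G y ≥ G x + (y - x) G'(x) + δ (y - x)²` for all `x, y` in `]c - ε, c + ε[`
(used for `G` of class `C¹`). -/
def StronglyConvexNear (G : ℝ → ℝ) (c : ℝ) : Prop :=
  ∃ ε > 0, ∃ δ > 0, ∀ x ∈ Ioo (c - ε) (c + ε), ∀ y ∈ Ioo (c - ε) (c + ε),
    G x + (y - x) * deriv G x + δ * (y - x) ^ 2 ≤ G y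

/-- `G` is strongly concave in the neighbourhood of `c`: `-G` is strongly convex there. -/
def StronglyConcaveNear (G : ℝ → ℝ) (c : ℝ) : Prop :=
  StronglyConvexNear (fun x => -G x) c

/-- `x` restricts to a `C²` solution on `[0, ∞)` of `x'' + a(t) x' + G'(x) = 0` with
`x(0) = p.1` and `x'(0) = p.2`. Derivatives are taken within `[0, ∞)`, hence are one-sided at `0`,
and the values of `x` at negative times play no role. -/
structure IsSolutionFrom (a G : ℝ → ℝ) (p : ℝ × ℝ) (x : ℝ → ℝ) : Prop where
  contDiffOn : ContDiffOn ℝ 2 x (Ici 0)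
  equation : ∀ t, 0 ≤ t →
    derivWithin (derivWithin x (Ici 0)) (Ici 0) t + a t * derivWithin x (Ici 0) t
      + deriv G (x t) = 0
  initial_position : x 0 = p.1
  initial_velocity : derivWithin x (Ici 0) 0 = p.2

/-- The initial data `(x₀, x₁)` whose solution converges, as `t → ∞`, to a local minimum of `G`. -/
def dataConvergingToLocalMin (a G : ℝ → ℝ) : Set (ℝ × ℝ) :=
  {p | ∃ x, IsSolutionFrom a G p x ∧ ∃ m, IsLocalMin G m ∧ Tendsto x atTop (𝓝 m)}

/-! Along a solution the energy `v ^ 2 / 2 + G x` has derivative `-(a t * v ^ 2)`, and by coercivity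
its sublevels are bounded in the plane. Solutions of a truncated, globally Lipschitz system
therefore never meet the truncation, which gives existence, uniqueness and continuous dependence.

Convergence. The energy decreases to some limit `e`. If the velocity does not tend to 0, it is at
least some `v₀` in absolute value at arbitrarily late times `s`, and each such moment costs energy
of order `1 / (s + 1)` (`IsTraj.exists_energy_loss`). Slow phases in between are short: away from
critical points at level `e` the force is bounded below, near a strongly convex one a trapped
trajectory would have velocity tending to 0, and near a strongly concave one the passage takes time
logarithmic in the inverse excess energy (`passage_time_le`). Since the excess is at least the next
loss, gaps are `O(log s)`, and the total loss diverges like `∑ 1 / (n log n)`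
(`false_of_logarithmic_losses`), which is absurd. Hence `v → 0`, so `G'(x) → 0` and `G(x) → e`; as
critical values are distinct, `x` converges to a critical point.

Openness. Being inside the well of a strict minimum with energy below its rim, at one fixed time, is
an open condition and decides the limit.

Density. All other data converge to a strongly concave point, hence stay near it from some time on.
For a given starting time such data form a closed set without interior: two trajectories displaced
along the unstable direction `(1, 1)` separate (`IsTraj.false_of_separated`), and the time-`T` map
is open (`IsTraj.exists_isTraj_through`). Baire's theorem concludes. -/

/-! ### Tools for ordinary differential equations. -/

open Metric in
/-- A bounded, globally Lipschitz, time-dependent vector field on a Banach space has a global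
solution through every initial condition. -/
theorem exists_hasDerivAt_of_lipschitzWith_of_bounded {E : Type*} [NormedAddCommGroup E]
    [NormedSpace ℝ E] [CompleteSpace E] {f : ℝ → E → E} {K L : NNReal}
    (hlip : ∀ t, LipschitzWith K (f t)) (hcont : ∀ x, Continuous fun t => f t x)
    (hbdd : ∀ t x, ‖f t x‖ ≤ L) (t₀ : ℝ) (x₀ : E) :
    ∃ γ : ℝ → E, γ t₀ = x₀ ∧ ∀ t, HasDerivAt γ (f t (γ t)) t := by
  have local_sol (n : ℕ) : ∃ γ : ℝ → E, γ t₀ = x₀ ∧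
      ∀ t ∈ Ioo (t₀ - (n + 1)) (t₀ + (n + 1)), HasDerivAt γ (f t (γ t)) t := by
    have hn : (0 : ℝ) ≤ n := n.cast_nonneg
    -- `L * (n + 1)` is the farthest a curve of speed at most `L` can travel in time `n + 1`.
    have h : IsPicardLindelof f (tmin := t₀ - (n + 1)) (tmax := t₀ + (n + 1))
        ⟨t₀, by constructor <;> linarith⟩ x₀ (L * (n + 1)) 0 L K :=
      { lipschitzOnWith := fun t _ => (hlip t).lipschitzOnWith
        continuousOn := fun x _ => (hcont x).continuousOn
        norm_le := fun t _ x _ => hbdd t x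
        mul_max_le := by simp }
    obtain ⟨γ, h0, hγ⟩ := h.exists_eq_forall_mem_Icc_hasDerivWithinAt₀
    exact ⟨γ, h0, fun t ht => (hγ t (Ioo_subset_Icc_self ht)).hasDerivAt (Icc_mem_nhds ht.1 ht.2)⟩
  choose g hg0 hg using local_sol
  have agree (m n : ℕ) (hmn : m ≤ n) :
      EqOn (g m) (g n) (Ioo (t₀ - (m + 1)) (t₀ + (m + 1))) := by
    have hm : (0 : ℝ) ≤ m := m.cast_nonneg
    have hmn' : (m : ℝ) ≤ n := by exact_mod_cast hmn
    refine ODE_solution_unique_of_mem_Ioo (v := f) (s := fun _ => univ) (K := K) (t₀ := t₀)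
      (fun t _ => (hlip t).lipschitzOnWith) ⟨by linarith, by linarith⟩
      (fun t ht => ⟨hg m t ht, trivial⟩) (fun t ht => ⟨hg n t ⟨?_, ?_⟩, trivial⟩) ?_
    · linarith [ht.1]
    · linarith [ht.2]
    · rw [hg0, hg0]
  have eq_of_lt (n : ℕ) (t : ℝ) (ht : |t - t₀| < n + 1) : g ⌈|t - t₀|⌉₊ t = g n t := by
    have h1 : |t - t₀| < (⌈|t - t₀|⌉₊ : ℝ) + 1 := by
      linarith [Nat.le_ceil |t - t₀|]
    rcases le_total ⌈|t - t₀|⌉₊ n with h | h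
    · exact agree _ _ h ⟨by linarith [(abs_lt.1 h1).1], by linarith [(abs_lt.1 h1).2]⟩
    · exact (agree _ _ h ⟨by linarith [(abs_lt.1 ht).1], by linarith [(abs_lt.1 ht).2]⟩).symm
  -- The radius `n + 1` instead of `n` places `t` in the open interval on which the chosen local
  -- solution lives.
  refine ⟨fun t => g ⌈|t - t₀|⌉₊ t, by simp [hg0], fun t => ?_⟩
  obtain ⟨n, hn⟩ := exists_nat_gt |t - t₀|
  have hn1 : |t - t₀| < n + 1 := by linarith
  have hev : (fun s => g ⌈|s - t₀|⌉₊ s) =ᶠ[𝓝 t] g n := by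
    have : ∀ᶠ s in 𝓝 t, |s - t₀| < n + 1 :=
      (by fun_prop : Continuous fun s => |s - t₀|).continuousAt.eventually_lt_const hn1
    filter_upwards [this] with s hs using eq_of_lt n s hs
  have hd := hg n t ⟨by linarith [(abs_lt.1 hn1).1], by linarith [(abs_lt.1 hn1).2]⟩
  simpa only [eq_of_lt n t hn1] using hd.congr_of_eventuallyEq hev

/-- Two solutions of a Lipschitz differential equation on `[a, b]` stay exponentially close
backwards in time. -/
theorem dist_le_of_trajectories_ODE_backward {E : Type*} [NormedAddCommGroup E]
    [NormedSpace ℝ E] {f : ℝ → E → E} {K : NNReal} (hlip : ∀ t, LipschitzWith K (f t))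
    {γ η : ℝ → E} {a b δ : ℝ} (hγ : ∀ t ∈ Icc a b, HasDerivAt γ (f t (γ t)) t)
    (hη : ∀ t ∈ Icc a b, HasDerivAt η (f t (η t)) t) (hb : dist (γ b) (η b) ≤ δ) :
    ∀ t ∈ Icc a b, dist (γ t) (η t) ≤ δ * Real.exp (K * (b - t)) := by
  have rev {ζ : ℝ → E} (hζ : ∀ t ∈ Icc a b, HasDerivAt ζ (f t (ζ t)) t) :
      ∀ t ∈ Icc (-b) (-a), HasDerivAt (fun s => ζ (-s)) (-f (-t) (ζ (-t))) t := by
    intro t ht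
    have := (hζ (-t) ⟨by linarith [ht.2], by linarith [ht.1]⟩).scomp t (hasDerivAt_neg t)
    simpa [Function.comp_def] using this
  intro t ht
  have := dist_le_of_trajectories_ODE (v := fun t x => -f (-t) x) (K := K)
    (f := fun s => γ (-s)) (g := fun s => η (-s)) (a := -b) (b := -a) (δ := δ)
    (fun t => (hlip (-t)).neg)
    (fun s hs => (rev hγ s hs).continuousAt.continuousWithinAt)
    (fun s hs => (rev hγ s (Ico_subset_Icc_self hs)).hasDerivWithinAt)
    (fun s hs => (rev hη s hs).continuousAt.continuousWithinAt)
    (fun s hs => (rev hη s (Ico_subset_Icc_self hs)).hasDerivWithinAt)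
    (by simpa using hb) (-t) ⟨by linarith [ht.2], by linarith [ht.1]⟩
  simpa [add_comm, sub_eq_add_neg] using this

/-- A continuous function on `[a, b]` that starts below `R`, and cannot reach `R` at the end of a
period during which it is at most `R`, stays below `R`. -/
theorem lt_of_forall_prefix_lt {g : ℝ → ℝ} {a b R : ℝ} (hg : ContinuousOn g (Icc a b))
    (ha : g a < R)
    (hstep : ∀ τ ∈ Icc a b, (∀ s ∈ Icc a τ, g s ≤ R) → g τ < R) :
    ∀ t ∈ Icc a b, g t < R := by
  by_contra! hcon
  obtain ⟨t, ht, hgt⟩ := hcon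
  set S := {s ∈ Icc a b | R ≤ g s} with hS
  have hScl : IsClosed S := by
    have := hg.preimage_isClosed_of_isClosed isClosed_Icc (isClosed_Ici (a := R))
    exact this
  have hbdd : BddBelow S := ⟨a, fun s hs => hs.1.1⟩
  have hmem : sInf S ∈ S := hScl.csInf_mem ⟨t, ht, hgt⟩ hbdd
  set τ := sInf S
  have hlt : ∀ s ∈ Ico a τ, g s < R := by
    intro s hs
    by_contra! h
    exact absurd (csInf_le hbdd ⟨⟨hs.1, hs.2.le.trans hmem.1.2⟩, h⟩) (not_le.2 hs.2)
  have haτ : a < τ := by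
    rcases hmem.1.1.eq_or_lt with h | h
    · exact absurd hmem.2 (not_le.2 (h ▸ ha))
    · exact h
  have hle : ∀ s ∈ Icc a τ, g s ≤ R := by
    have hcl : closure (Ico a τ) = Icc a τ := closure_Ico haτ.ne
    intro s hs
    have hc : ContinuousOn g (closure (Ico a τ)) :=
      hcl ▸ hg.mono (Icc_subset_Icc_right hmem.1.2)
    exact le_on_closure (f := g) (g := fun _ => R) (fun s hs => (hlt s hs).le) hc
      continuousOn_const (hcl ▸ hs)
  exact absurd (hstep τ hmem.1 hle) (not_lt.2 hmem.2)

/-! ### The damped system, its energy and its truncation. -/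

/-- `x` and `v` are the position and the velocity of a solution of `x'' + a(t) x' + G'(x) = 0`
on `[0, ∞)`. -/
structure IsTraj (a G x v : ℝ → ℝ) : Prop where
  hx : ∀ t, 0 ≤ t → HasDerivWithinAt x (v t) (Ici 0) t
  hv : ∀ t, 0 ≤ t → HasDerivWithinAt v (-(a t * v t) - deriv G (x t)) (Ici 0) t

/-- Nonnegative, non-increasing damping and a coercive `C¹` potential whose derivative is locally
Lipschitz. -/
structure DampedSystem (a G : ℝ → ℝ) : Prop where
  nonneg : ∀ t, 0 ≤ t → 0 ≤ a t
  cont : ContinuousOn a (Ici 0)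
  anti : AntitoneOn a (Ici 0)
  contDiff : ContDiff ℝ 1 G
  coercive : Tendsto G (cocompact ℝ) atTop
  lip : ∀ s : Set ℝ, Bornology.IsBounded s → ∃ K, LipschitzOnWith K (deriv G) s

/-- Mechanical energy. -/
noncomputable def energy (G x v : ℝ → ℝ) (t : ℝ) : ℝ := v t ^ 2 / 2 + G (x t)

theorem DampedSystem.hasDerivAt {a G : ℝ → ℝ} (h : DampedSystem a G) (y : ℝ) :
    HasDerivAt G (deriv G y) y :=
  (h.contDiff.differentiable one_ne_zero y).hasDerivAt

theorem DampedSystem.continuous_deriv {a G : ℝ → ℝ} (h : DampedSystem a G) :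
    Continuous (deriv G) :=
  h.contDiff.continuous_deriv le_rfl

theorem energy_hasDerivWithinAt {a G x v : ℝ → ℝ} (h : DampedSystem a G) {s : Set ℝ} {t : ℝ}
    (hx : HasDerivWithinAt x (v t) s t)
    (hv : HasDerivWithinAt v (-(a t * v t) - deriv G (x t)) s t) :
    HasDerivWithinAt (energy G x v) (-(a t * v t ^ 2)) s t := by
  have h1 := (hv.pow 2).div_const 2
  have h2 := (h.hasDerivAt (x t)).comp_hasDerivWithinAt t hx
  refine (h1.add h2).congr_deriv ?_
  push_cast
  ring

/-- A general convex time set is allowed because the existence proof needs monotonicity on `[0, τ]`,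
before the solution is known to be global. -/
theorem energy_antitoneOn {a G x v : ℝ → ℝ} (h : DampedSystem a G) {s : Set ℝ}
    (hs : Convex ℝ s) (h0 : s ⊆ Ici 0)
    (hx : ∀ t ∈ s, HasDerivWithinAt x (v t) s t)
    (hv : ∀ t ∈ s, HasDerivWithinAt v (-(a t * v t) - deriv G (x t)) s t) :
    AntitoneOn (energy G x v) s := by
  have hd : ∀ t ∈ s, HasDerivWithinAt (energy G x v) (-(a t * v t ^ 2)) s t := fun t ht =>
    energy_hasDerivWithinAt h (hx t ht) (hv t ht)
  refine antitoneOn_of_hasDerivWithinAt_nonpos hs (fun t ht => (hd t ht).continuousWithinAt)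
    (fun t ht => (hd t (interior_subset ht)).mono interior_subset) (fun t ht => ?_)
  have := h.nonneg t (h0 (interior_subset ht))
  have := sq_nonneg (v t)
  nlinarith [mul_nonneg ‹0 ≤ a t› this]

theorem IsTraj.energy_antitoneOn {a G x v : ℝ → ℝ} (h : DampedSystem a G) (hT : IsTraj a G x v) :
    AntitoneOn (energy G x v) (Ici 0) :=
  _root_.energy_antitoneOn h (convex_Ici 0) Subset.rfl hT.hx hT.hv

theorem DampedSystem.exists_lower_bound {a G : ℝ → ℝ} (h : DampedSystem a G) :
    ∃ m, ∀ y, m ≤ G y := by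
  obtain ⟨y, hy⟩ := h.contDiff.continuous.exists_forall_le h.coercive
  exact ⟨G y, hy⟩

/-- Energy sublevels are bounded in phase space. -/
theorem DampedSystem.exists_box {a G : ℝ → ℝ} (h : DampedSystem a G) (e : ℝ) :
    ∃ R > 0, ∀ y u : ℝ, u ^ 2 / 2 + G y ≤ e → |y| < R ∧ |u| < R := by
  obtain ⟨m, hm⟩ := h.exists_lower_bound
  have hev := h.coercive.eventually_gt_atTop e
  rw [← Metric.cobounded_eq_cocompact] at hev
  obtain ⟨r, hr⟩ := (Metric.hasBasis_cobounded_compl_closedBall (0 : ℝ)).eventually_iff.1 hev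
  have hy' : ∀ y, G y ≤ e → |y| ≤ r := by
    intro y hy
    by_contra hc
    have := hr.2 (x := y) (by simpa using hc)
    linarith
  have h1 := le_max_right r (2 * (e - m))
  have h2 := le_max_left r (2 * (e - m))
  have h3 := le_max_left (max r (2 * (e - m))) 0
  refine ⟨max (max r (2 * (e - m))) 0 + 2, by positivity, fun y u hyu => ⟨?_, ?_⟩⟩
  · linarith [hy' y (by nlinarith [sq_nonneg u])]
  · have h4 := hm y
    rw [abs_lt]
    constructor <;> nlinarith [sq_nonneg (u - 1), sq_nonneg (u + 1)]

/-- Truncation to `[-R, R]`. -/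
noncomputable def clamp (R y : ℝ) : ℝ := max (-R) (min y R)

theorem clamp_eq {R y : ℝ} (h : |y| ≤ R) : clamp R y = y := by
  rw [abs_le] at h
  simp [clamp, h.1, h.2]

theorem abs_clamp_le {R : ℝ} (hR : 0 ≤ R) (y : ℝ) : |clamp R y| ≤ R := by
  rw [abs_le]
  exact ⟨le_max_left _ _, max_le (by linarith) (min_le_right _ _)⟩

theorem lipschitzWith_clamp (R : ℝ) : LipschitzWith 1 (clamp R) :=
  (LipschitzWith.id.min_const R).const_max (-R)

theorem dist_clamp_le (R y z : ℝ) : |clamp R y - clamp R z| ≤ |y - z| := by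
  simpa [Real.dist_eq] using (lipschitzWith_clamp R).dist_le_mul y z

/-- The phase-space vector field, truncated to be bounded and extended to negative times. -/
noncomputable def truncField (a G : ℝ → ℝ) (R t : ℝ) (w : ℝ × ℝ) : ℝ × ℝ :=
  (clamp R w.2, -(a (max t 0) * clamp R w.2) - deriv G (clamp R w.1))

theorem truncField_eq {a G : ℝ → ℝ} {R t : ℝ} {w : ℝ × ℝ} (ht : 0 ≤ t) (h1 : |w.1| ≤ R)
    (h2 : |w.2| ≤ R) : truncField a G R t w = (w.2, -(a t * w.2) - deriv G w.1) := by
  simp [truncField, clamp_eq h1, clamp_eq h2, ht]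

namespace DampedSystem

variable {a G : ℝ → ℝ}

theorem abs_damping_le (h : DampedSystem a G) (t : ℝ) : |a (max t 0)| ≤ a 0 := by
  rw [abs_of_nonneg (h.nonneg _ (le_max_right t 0))]
  exact h.anti (mem_Ici.2 le_rfl) (mem_Ici.2 (le_max_right t 0)) (le_max_right t 0)

theorem exists_lipschitzWith_truncField (h : DampedSystem a G) {R : ℝ} (hR : 0 ≤ R) :
    ∃ K : NNReal, ∀ t, LipschitzWith K (truncField a G R t) := by
  obtain ⟨K, hK⟩ := h.lip (Icc (-R) R) (Metric.isBounded_Icc _ _)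
  have ha0 := h.nonneg 0 le_rfl
  refine ⟨1 + (a 0).toNNReal + K, fun t => LipschitzWith.of_dist_le_mul fun w z => ?_⟩
  have e1 : |w.1 - z.1| ≤ dist w z := by
    rw [Prod.dist_eq]; exact le_max_left _ _
  have e2 : |w.2 - z.2| ≤ dist w z := by
    rw [Prod.dist_eq]; exact le_max_right _ _
  have hd : 0 ≤ dist w z := dist_nonneg
  have c1 := dist_clamp_le R w.1 z.1
  have c2 := dist_clamp_le R w.2 z.2
  have hg : |deriv G (clamp R w.1) - deriv G (clamp R z.1)|
      ≤ K * |clamp R w.1 - clamp R z.1| := by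
    simpa [Real.dist_eq] using hK.dist_le_mul _ (_root_.abs_le.1 (abs_clamp_le hR w.1)) _
      (_root_.abs_le.1 (abs_clamp_le hR z.1))
  have hK0 : (0 : ℝ) ≤ K := K.2
  rw [Prod.dist_eq]
  push_cast
  rw [Real.coe_toNNReal _ ha0]
  refine max_le ?_ ?_
  · have : |clamp R w.2 - clamp R z.2| ≤ dist w z := c2.trans e2
    simp only [truncField, Real.dist_eq]
    nlinarith [mul_nonneg ha0 hd, mul_nonneg hK0 hd]
  · simp only [truncField, Real.dist_eq]
    have h1 : |(-(a (max t 0) * clamp R w.2) - deriv G (clamp R w.1))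
        - (-(a (max t 0) * clamp R z.2) - deriv G (clamp R z.1))|
        ≤ |a (max t 0)| * |clamp R w.2 - clamp R z.2|
          + |deriv G (clamp R w.1) - deriv G (clamp R z.1)| := by
      rw [← abs_mul, ← abs_neg (a (max t 0) * _)]
      refine le_trans (le_of_eq ?_) (abs_sub _ _)
      ring_nf
    have h2 : |a (max t 0)| * |clamp R w.2 - clamp R z.2| ≤ a 0 * dist w z :=
      mul_le_mul (h.abs_damping_le t) (c2.trans e2) (abs_nonneg _) ha0
    have h3 : (K : ℝ) * |clamp R w.1 - clamp R z.1| ≤ K * dist w z :=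
      mul_le_mul_of_nonneg_left (c1.trans e1) hK0
    linarith

theorem exists_bound_truncField (h : DampedSystem a G) {R : ℝ} (hR : 0 ≤ R) :
    ∃ L : NNReal, ∀ t w, ‖truncField a G R t w‖ ≤ L := by
  obtain ⟨B, hB⟩ := isCompact_Icc.exists_bound_of_continuousOn (s := Icc (-R) R)
    h.continuous_deriv.continuousOn
  have ha0 := h.nonneg 0 le_rfl
  have hB0 : 0 ≤ B := (norm_nonneg _).trans (hB 0 ⟨by linarith, hR⟩)
  refine ⟨(R + a 0 * R + B).toNNReal, fun t w => ?_⟩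
  rw [Real.coe_toNNReal _ (by positivity), Prod.norm_def]
  have c2 := abs_clamp_le hR w.2
  have hb := hB _ (_root_.abs_le.1 (abs_clamp_le hR w.1))
  have h2 : |a (max t 0) * clamp R w.2| ≤ a 0 * R := by
    rw [abs_mul]
    exact mul_le_mul (h.abs_damping_le t) c2 (abs_nonneg _) ha0
  refine max_le ?_ ?_
  · simp only [truncField, Real.norm_eq_abs]
    nlinarith [mul_nonneg ha0 hR]
  · simp only [truncField]
    refine (norm_sub_le _ _).trans ?_
    rw [norm_neg, Real.norm_eq_abs]
    linarith

theorem continuous_truncField (h : DampedSystem a G) (R : ℝ) (w : ℝ × ℝ) :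
    Continuous fun t => truncField a G R t w := by
  have : Continuous fun t => a (max t 0) :=
    h.cont.comp_continuous (by fun_prop) fun t => le_max_right t 0
  exact continuous_const.prodMk ((this.mul continuous_const).neg.sub continuous_const)

theorem exists_truncated_solution (h : DampedSystem a G) {R : ℝ} (hR : 0 ≤ R) (t₀ : ℝ)
    (w : ℝ × ℝ) : ∃ γ : ℝ → ℝ × ℝ, γ t₀ = w ∧ ∀ t, HasDerivAt γ (truncField a G R t (γ t)) t := by
  obtain ⟨K, hK⟩ := h.exists_lipschitzWith_truncField hR
  obtain ⟨L, hL⟩ := h.exists_bound_truncField hR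
  exact exists_hasDerivAt_of_lipschitzWith_of_bounded hK (h.continuous_truncField R) hL t₀ w

end DampedSystem

/-! ### Existence, uniqueness and dependence on initial data. -/

section Flow

variable {a G x v y u : ℝ → ℝ}

theorem IsTraj.energy_le (h : DampedSystem a G) (hT : IsTraj a G x v) {t : ℝ} (ht : 0 ≤ t) :
    v t ^ 2 / 2 + G (x t) ≤ energy G x v 0 :=
  hT.energy_antitoneOn h (mem_Ici.2 le_rfl) (mem_Ici.2 ht) ht

theorem IsTraj.hasDerivWithinAt_truncField (hT : IsTraj a G x v) {R t : ℝ} (ht : 0 ≤ t)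
    (h1 : |x t| ≤ R) (h2 : |v t| ≤ R) :
    HasDerivWithinAt (fun s => (x s, v s)) (truncField a G R t (x t, v t)) (Ici 0) t := by
  rw [truncField_eq ht h1 h2]
  exact (hT.hx t ht).prodMk (hT.hv t ht)

theorem hasDerivAt_of_truncField {γ : ℝ → ℝ × ℝ} {R t : ℝ}
    (hγ : HasDerivAt γ (truncField a G R t (γ t)) t) (ht : 0 ≤ t)
    (h1 : |(γ t).1| ≤ R) (h2 : |(γ t).2| ≤ R) :
    HasDerivAt (fun s => (γ s).1) ((γ t).2) t ∧
      HasDerivAt (fun s => (γ s).2) (-(a t * (γ t).2) - deriv G (γ t).1) t := by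
  rw [truncField_eq ht h1 h2] at hγ
  exact ⟨hγ.fst, hγ.snd⟩

/-- While the truncated solution stays in the closed box it solves the true equation, so its energy
has not increased and it is in fact in the open box; it can therefore never reach the boundary. -/
theorem DampedSystem.exists_isTraj (h : DampedSystem a G) (p : ℝ × ℝ) :
    ∃ x v, IsTraj a G x v ∧ x 0 = p.1 ∧ v 0 = p.2 := by
  obtain ⟨R, hR, hbox⟩ := h.exists_box (p.2 ^ 2 / 2 + G p.1)
  obtain ⟨γ, h0, hγ⟩ := h.exists_truncated_solution hR.le 0 p
  have hcont : Continuous γ := continuous_iff_continuousAt.2 fun t => (hγ t).continuousAt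
  have hin : ∀ t, 0 ≤ t → max |(γ t).1| |(γ t).2| < R := by
    intro t ht
    refine lt_of_forall_prefix_lt (g := fun t => max |(γ t).1| |(γ t).2|) (a := 0) (b := t)
      (by fun_prop) ?_ ?_ t ⟨ht, le_rfl⟩
    · simpa [h0] using hbox p.1 p.2 le_rfl
    · intro τ hτ hle
      have key : ∀ s ∈ Icc 0 τ, _ := fun s hs => hasDerivAt_of_truncField (hγ s) hs.1
        ((le_max_left _ _).trans (hle s hs)) ((le_max_right _ _).trans (hle s hs))
      have hE := energy_antitoneOn (x := fun s => (γ s).1) (v := fun s => (γ s).2) h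
        (convex_Icc 0 τ) (fun s hs => hs.1)
        (fun s hs => (key s hs).1.hasDerivWithinAt) (fun s hs => (key s hs).2.hasDerivWithinAt)
        (left_mem_Icc.2 hτ.1) (right_mem_Icc.2 hτ.1) hτ.1
      have hE' : (γ τ).2 ^ 2 / 2 + G (γ τ).1 ≤ p.2 ^ 2 / 2 + G p.1 := by
        simpa [energy, h0] using hE
      exact max_lt (hbox _ _ hE').1 (hbox _ _ hE').2
  have key : ∀ s : ℝ, 0 ≤ s → _ := fun s hs => hasDerivAt_of_truncField (hγ s) hs
    ((le_max_left _ _).trans (hin s hs).le) ((le_max_right _ _).trans (hin s hs).le)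
  exact ⟨fun t => (γ t).1, fun t => (γ t).2, ⟨fun t ht => (key t ht).1.hasDerivWithinAt,
    fun t ht => (key t ht).2.hasDerivWithinAt⟩, by simp [h0], by simp [h0]⟩

/-- Trajectories of bounded energy depend on the initial data in a Lipschitz way, locally uniformly
in time. -/
theorem DampedSystem.exists_dist_le (h : DampedSystem a G) (e : ℝ) :
    ∃ K : NNReal, ∀ x v y u, IsTraj a G x v → IsTraj a G y u → energy G x v 0 ≤ e →
      energy G y u 0 ≤ e → ∀ t, 0 ≤ t →
      dist (x t, v t) (y t, u t) ≤ dist (x 0, v 0) (y 0, u 0) * Real.exp (K * t) := by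
  obtain ⟨R, hR, hbox⟩ := h.exists_box e
  obtain ⟨K, hK⟩ := h.exists_lipschitzWith_truncField hR.le
  refine ⟨K, fun x v y u hT hT' hx hy t ht => ?_⟩
  have key {x v : ℝ → ℝ} (hT : IsTraj a G x v) (hx : energy G x v 0 ≤ e) (s : ℝ) (hs : 0 ≤ s) :
      HasDerivWithinAt (fun s => (x s, v s)) (truncField a G R s (x s, v s)) (Ici 0) s :=
    hT.hasDerivWithinAt_truncField hs (hbox _ _ ((hT.energy_le h hs).trans hx)).1.le
      (hbox _ _ ((hT.energy_le h hs).trans hx)).2.le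
  have hsub : Icc 0 t ⊆ Ici (0 : ℝ) := fun s hs => hs.1
  have := dist_le_of_trajectories_ODE (a := 0) (b := t) hK
    (fun s hs => (key hT hx s hs.1).continuousWithinAt.mono hsub)
    (fun s hs => (key hT hx s hs.1).mono (Ici_subset_Ici.2 hs.1))
    (fun s hs => (key hT' hy s hs.1).continuousWithinAt.mono hsub)
    (fun s hs => (key hT' hy s hs.1).mono (Ici_subset_Ici.2 hs.1)) le_rfl t ⟨ht, le_rfl⟩
  simpa using this

theorem IsTraj.eq_of_initial_eq (h : DampedSystem a G) (hT : IsTraj a G x v)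
    (hT' : IsTraj a G y u) (h0 : x 0 = y 0) (h0' : v 0 = u 0) {t : ℝ} (ht : 0 ≤ t) :
    x t = y t ∧ v t = u t := by
  obtain ⟨K, hK⟩ := h.exists_dist_le (energy G x v 0)
  have := hK x v y u hT hT' le_rfl (by simp [energy, h0, h0']) t ht
  rw [h0, h0', dist_self, zero_mul, dist_le_zero, Prod.mk.injEq] at this
  exact this

/-- The time-`T` map is open: points near `(x T, v T)` are reached from data near `(x 0, v 0)`. -/
theorem IsTraj.exists_isTraj_through (h : DampedSystem a G) (hT : IsTraj a G x v) {T ε : ℝ}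
    (hT0 : 0 ≤ T) (hε : 0 < ε) :
    ∃ δ > 0, ∀ w : ℝ × ℝ, dist w (x T, v T) < δ → ∃ y u, IsTraj a G y u ∧
      dist (y 0, u 0) (x 0, v 0) < ε ∧ (y T, u T) = w := by
  obtain ⟨R, hR, hbox⟩ := h.exists_box (energy G x v 0)
  have hR1 : 0 ≤ R + 1 := by linarith
  obtain ⟨K, hK⟩ := h.exists_lipschitzWith_truncField hR1
  -- `η` extends `(x, v)` to negative times: the backward estimate needs two-sided derivatives, also
  -- at 0.
  obtain ⟨η, hη0, hη⟩ := h.exists_truncated_solution hR1 0 (x 0, v 0)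
  have hxv : ∀ t, 0 ≤ t → |x t| < R ∧ |v t| < R := fun t ht => hbox _ _ (hT.energy_le h ht)
  have key (s : ℝ) (hs : 0 ≤ s) :
      HasDerivWithinAt (fun s => (x s, v s)) (truncField a G (R + 1) s (x s, v s)) (Ici 0) s :=
    hT.hasDerivWithinAt_truncField hs (by linarith [(hxv s hs).1]) (by linarith [(hxv s hs).2])
  have heq : ∀ t, 0 ≤ t → η t = (x t, v t) := by
    intro t ht
    exact ODE_solution_unique (a := 0) (b := t) hK
      (fun s _ => (hη s).continuousAt.continuousWithinAt)
      (fun s _ => (hη s).hasDerivWithinAt)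
      (fun s hs => (key s hs.1).continuousWithinAt.mono fun s hs => hs.1)
      (fun s hs => (key s hs.1).mono (Ici_subset_Ici.2 hs.1)) hη0 ⟨ht, le_rfl⟩
  -- Backwards over time `T` distances grow by at most `exp (K * T)`. The bound 1 keeps the
  -- perturbed curve in the box of radius `R + 1`, where the truncation is inactive.
  refine ⟨min ε 1 / Real.exp (K * T), by positivity, fun w hw => ?_⟩
  obtain ⟨γ, hγT, hγ⟩ := h.exists_truncated_solution hR1 T w
  have hclose : ∀ t ∈ Icc 0 T, dist (γ t) (x t, v t) < min ε 1 := by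
    intro t ht
    have h1 := dist_le_of_trajectories_ODE_backward hK (fun t _ => hγ t) (fun t _ => hη t)
      (a := 0) (b := T) le_rfl t ht
    rw [heq t ht.1, heq T hT0, hγT] at h1
    rw [lt_div_iff₀ (by positivity)] at hw
    refine h1.trans_lt (lt_of_le_of_lt ?_ hw)
    gcongr
    linarith [ht.1]
  have hin : ∀ t ∈ Icc 0 T, |(γ t).1| < R + 1 ∧ |(γ t).2| < R + 1 := by
    intro t ht
    have h1 := (hclose t ht).trans_le (min_le_right _ _)
    rw [Prod.dist_eq, max_lt_iff, Real.dist_eq, Real.dist_eq] at h1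
    obtain ⟨h2, h3⟩ := hxv t ht.1
    constructor
    · linarith [abs_sub_abs_le_abs_sub (γ t).1 (x t), h1.1]
    · linarith [abs_sub_abs_le_abs_sub (γ t).2 (v t), h1.2]
  obtain ⟨y, u, hT', hy0, hu0⟩ := h.exists_isTraj (γ 0)
  obtain ⟨R', hR', hbox'⟩ := h.exists_box (energy G y u 0)
  -- The truncated curve `γ` and the true trajectory are bounded by different radii; truncating at
  -- the larger one makes both solve the same equation.
  have hRm : 0 ≤ max R' (R + 1) := hR'.le.trans (le_max_left _ _)
  obtain ⟨K', hK'⟩ := h.exists_lipschitzWith_truncField hRm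
  have key1 (s : ℝ) (hs : 0 ≤ s) : HasDerivWithinAt (fun s => (y s, u s))
      (truncField a G (max R' (R + 1)) s (y s, u s)) (Ici 0) s :=
    hT'.hasDerivWithinAt_truncField hs
      ((hbox' _ _ (hT'.energy_le h hs)).1.le.trans (le_max_left _ _))
      ((hbox' _ _ (hT'.energy_le h hs)).2.le.trans (le_max_left _ _))
  have key2 (s : ℝ) (hs : s ∈ Icc 0 T) :
      HasDerivAt γ (truncField a G (max R' (R + 1)) s (γ s)) s := by
    have h1 := hγ s
    rw [truncField_eq hs.1 (hin s hs).1.le (hin s hs).2.le] at h1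
    rwa [truncField_eq hs.1 ((hin s hs).1.le.trans (le_max_right _ _))
      ((hin s hs).2.le.trans (le_max_right _ _))]
  have hγy : γ T = (y T, u T) :=
    ODE_solution_unique (a := 0) (b := T) (f := γ) (g := fun s => (y s, u s)) hK'
      (fun s hs => (key2 s hs).continuousAt.continuousWithinAt)
      (fun s hs => (key2 s (Ico_subset_Icc_self hs)).hasDerivWithinAt)
      (fun s hs => (key1 s hs.1).continuousWithinAt.mono fun s hs => hs.1)
      (fun s hs => (key1 s hs.1).mono (Ici_subset_Ici.2 hs.1))
      (by simp [hy0, hu0]) ⟨hT0, le_rfl⟩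
  refine ⟨y, u, hT', ?_, by rw [← hγy, hγT]⟩
  have := (hclose 0 ⟨le_rfl, hT0⟩).trans_le (min_le_left _ _)
  simpa [hy0, hu0] using this

theorem IsTraj.continuousOn_fst (hT : IsTraj a G x v) : ContinuousOn x (Ici 0) :=
  fun t ht => (hT.hx t ht).continuousWithinAt

theorem IsTraj.continuousOn_snd (hT : IsTraj a G x v) : ContinuousOn v (Ici 0) :=
  fun t ht => (hT.hv t ht).continuousWithinAt

theorem IsTraj.hasDerivAt_fst (hT : IsTraj a G x v) {t : ℝ} (ht : 0 < t) :
    HasDerivAt x (v t) t :=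
  (hT.hx t ht.le).hasDerivAt (Ici_mem_nhds ht)

theorem IsTraj.hasDerivAt_snd (hT : IsTraj a G x v) {t : ℝ} (ht : 0 < t) :
    HasDerivAt v (-(a t * v t) - deriv G (x t)) t :=
  (hT.hv t ht.le).hasDerivAt (Ici_mem_nhds ht)

theorem IsTraj.isSolutionFrom (h : DampedSystem a G) (hT : IsTraj a G x v) :
    IsSolutionFrom a G (x 0, v 0) x := by
  have hU : UniqueDiffOn ℝ (Ici (0 : ℝ)) := uniqueDiffOn_Ici 0
  have h1 : EqOn (derivWithin x (Ici 0)) v (Ici 0) := fun t ht =>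
    (hT.hx t ht).derivWithin (hU t ht)
  have h2 : EqOn (derivWithin (derivWithin x (Ici 0)) (Ici 0))
      (fun t => -(a t * v t) - deriv G (x t)) (Ici 0) := fun t ht => by
    rw [derivWithin_congr h1 (h1 ht)]
    exact (hT.hv t ht).derivWithin (hU t ht)
  refine ⟨?_, fun t ht => ?_, rfl, h1 (mem_Ici.2 le_rfl)⟩
  · rw [show (2 : WithTop ℕ∞) = 1 + 1 by norm_num, contDiffOn_succ_iff_derivWithin hU]
    refine ⟨fun t ht => (hT.hx t ht).differentiableWithinAt, by simp, ?_⟩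
    rw [contDiffOn_one_iff_derivWithin hU]
    refine ⟨fun t ht => ((hT.hv t ht).congr h1 (h1 ht)).differentiableWithinAt, ?_⟩
    refine ContinuousOn.congr ?_ h2
    exact (h.cont.mul hT.continuousOn_snd).neg.sub
      (h.continuous_deriv.comp_continuousOn hT.continuousOn_fst)
  · rw [h2 (mem_Ici.2 ht), h1 (mem_Ici.2 ht)]
    ring

theorem IsSolutionFrom.isTraj {p : ℝ × ℝ} (hS : IsSolutionFrom a G p x) :
    IsTraj a G x (derivWithin x (Ici 0)) := by
  have hU : UniqueDiffOn ℝ (Ici (0 : ℝ)) := uniqueDiffOn_Ici 0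
  have h2 := hS.contDiffOn
  rw [show (2 : WithTop ℕ∞) = 1 + 1 by norm_num, contDiffOn_succ_iff_derivWithin hU] at h2
  refine ⟨fun t ht => (h2.1 t ht).hasDerivWithinAt, fun t ht => ?_⟩
  have h3 := (h2.2.2.differentiableOn one_ne_zero t ht).hasDerivWithinAt
  exact h3.congr_deriv (by linarith [hS.equation t ht])

end Flow

/-! ### Durations of passages and logarithmic gaps. -/

theorem exists_sub_eq_mul_of_hasDerivAt {f f' : ℝ → ℝ} {t s : ℝ} (hts : t < s)
    (hf : ∀ r ∈ Icc t s, HasDerivAt f (f' r) r) :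
    ∃ ξ ∈ Ioo t s, f s - f t = f' ξ * (s - t) := by
  obtain ⟨ξ, hξ, h⟩ := exists_hasDerivAt_eq_slope f f' hts
    (fun r hr => (hf r hr).continuousAt.continuousWithinAt)
    (fun r hr => hf r (Ioo_subset_Icc_self hr))
  refine ⟨ξ, hξ, ?_⟩
  rw [h, div_mul_cancel₀ _ (sub_pos.2 hts).ne']

theorem sub_le_of_le_abs_deriv {f f' : ℝ → ℝ} {t s m M : ℝ} (hts : t ≤ s) (hm : 0 < m)
    (hM : 0 ≤ M) (hf : ∀ r ∈ Icc t s, HasDerivAt f (f' r) r)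
    (hf' : ∀ r ∈ Icc t s, m ≤ |f' r|) (hbd : ∀ r ∈ Icc t s, |f r| ≤ M) :
    s - t ≤ 2 * M / m := by
  rcases hts.eq_or_lt with rfl | hlt
  · rw [sub_self]; positivity
  obtain ⟨ξ, hξ, h⟩ := exists_sub_eq_mul_of_hasDerivAt hlt hf
  rw [le_div_iff₀ hm]
  have h1 := hf' ξ (Ioo_subset_Icc_self hξ)
  have h2 : |f' ξ| * (s - t) = |f s - f t| := by
    rw [h, abs_mul, abs_of_pos (sub_pos.2 hlt)]
  have h3 := abs_sub (f s) (f t)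
  have h4 := hbd s (right_mem_Icc.2 hts)
  have h5 := hbd t (left_mem_Icc.2 hts)
  nlinarith

theorem arsinh_le_log {y : ℝ} (hy : 0 ≤ y) : Real.arsinh y ≤ Real.log (1 + 2 * y) := by
  rw [Real.arsinh]
  have h : √(1 + y ^ 2) ≤ 1 + y := by
    rw [Real.sqrt_le_left (by linarith)]
    nlinarith
  exact Real.log_le_log (by positivity) (by linarith)

/-- Passage near a saddle: the time spent is logarithmic in the excess energy. -/
theorem passage_time_le {y v : ℝ → ℝ} {t s e δ ρ : ℝ} (hts : t ≤ s) (he : 0 < e) (hδ : 0 < δ)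
    (hρ : 0 < ρ) (hy : ∀ r ∈ Icc t s, HasDerivAt y (v r) r)
    (hv : ∀ r ∈ Icc t s, e + δ * y r ^ 2 ≤ v r ^ 2 / 2) (hyρ : ∀ r ∈ Icc t s, |y r| ≤ ρ) :
    s - t ≤ 2 * Real.log (1 + 2 * (√(δ / e) * ρ)) / √(2 * δ) := by
  -- With this `k`, the hypothesis on `v` reads `v ^ 2 ≥ 2 * e * (1 + (k * y) ^ 2)`, so `arsinh (k *
  -- y)` moves at speed at least `√(2 * δ)`.
  set k := √(δ / e) with hk
  have hk0 : 0 < k := Real.sqrt_pos.2 (by positivity)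
  have hk2 : k ^ 2 = δ / e := Real.sq_sqrt (by positivity)
  refine sub_le_of_le_abs_deriv (f := fun r => Real.arsinh (k * y r))
    (f' := fun r => (√(1 + (k * y r) ^ 2))⁻¹ • (k * v r)) hts (by positivity)
    (Real.log_nonneg (by nlinarith [mul_pos hk0 hρ]))
    (fun r hr => ((hy r hr).const_mul k).arsinh) (fun r hr => ?_) (fun r hr => ?_)
  · have hpos : 0 < √(1 + (k * y r) ^ 2) := Real.sqrt_pos.2 (by positivity)
    rw [smul_eq_mul, abs_mul, abs_inv, abs_of_pos hpos, inv_mul_eq_div, le_div_iff₀ hpos,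
      ← Real.sqrt_mul (by positivity)]
    refine Real.sqrt_le_iff.2 ⟨abs_nonneg _, ?_⟩
    rw [sq_abs, mul_pow, mul_pow, hk2]
    have h1 := hv r hr
    have h2 : δ / e * v r ^ 2 - 2 * δ * (1 + δ / e * y r ^ 2)
        = 2 * (δ / e) * (v r ^ 2 / 2 - (e + δ * y r ^ 2)) := by
      field_simp
    have h3 : 0 ≤ 2 * (δ / e) * (v r ^ 2 / 2 - (e + δ * y r ^ 2)) :=
      mul_nonneg (by positivity) (by linarith)
    linarith
  · have h1 : |k * y r| ≤ k * ρ := by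
      rw [abs_mul, abs_of_pos hk0]
      exact mul_le_mul_of_nonneg_left (hyρ r hr) hk0.le
    refine le_trans ?_ (arsinh_le_log (by positivity : 0 ≤ k * ρ))
    rw [abs_le] at h1 ⊢
    rw [← Real.arsinh_neg]
    exact ⟨Real.arsinh_le_arsinh.2 h1.1, Real.arsinh_le_arsinh.2 h1.2⟩

/-- By the arithmetic-geometric mean inequality `2 * √(δ / e) ≤ δ + 1 / e`, and `1 + ρ * (δ + 1 /
e)` is at most `(1 + ρ * δ + ρ) * (1 + 1 / e)`. -/
theorem exists_log_bound {δ ρ : ℝ} (hδ : 0 < δ) (hρ : 0 < ρ) :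
    ∃ C ≥ 0, ∀ e > 0, 2 * Real.log (1 + 2 * (√(δ / e) * ρ)) / √(2 * δ)
      ≤ C * (1 + Real.log (1 + 1 / e)) := by
  have hA : 0 ≤ Real.log (1 + ρ * δ + ρ) := Real.log_nonneg (by nlinarith [mul_pos hρ hδ])
  refine ⟨2 * (1 + Real.log (1 + ρ * δ + ρ)) / √(2 * δ), by positivity, fun e he => ?_⟩
  have hl : 0 ≤ Real.log (1 + 1 / e) := Real.log_nonneg (by simp [he.le])
  have h1 : 2 * √(δ / e) ≤ δ + 1 / e := by
    have h3 : √(δ / e) = √δ * √(1 / e) := by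
      rw [← Real.sqrt_mul hδ.le, mul_one_div]
    have h4 := Real.sq_sqrt hδ.le
    have h5 := Real.sq_sqrt (one_div_pos.2 he).le
    rw [h3]
    nlinarith [sq_nonneg (√δ - √(1 / e))]
  have h2 : Real.log (1 + 2 * (√(δ / e) * ρ)) ≤
      Real.log (1 + ρ * δ + ρ) + Real.log (1 + 1 / e) := by
    rw [← Real.log_mul (by positivity) (by positivity)]
    refine Real.log_le_log (by positivity) ?_
    have : 0 < 1 / e := by positivity
    nlinarith [mul_pos hρ hδ, mul_pos (mul_pos hρ hδ) this]
  rw [div_mul_eq_mul_div]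
  refine div_le_div_of_nonneg_right ?_ (Real.sqrt_nonneg _)
  nlinarith [mul_nonneg hA hl]

/-- The end `s` occurs on both sides of the assumed bound. Since the logarithm is sublinear, `s` is
first seen to be at most a multiple of `t + 2`; substituting this back makes the gap logarithmic in
`t`. -/
theorem exists_log_mul_bound {C : ℝ} (hC : 0 ≤ C) {κ : ℝ} (hκ : 0 < κ) :
    ∃ M > 0, ∀ t s : ℝ, 0 ≤ t → t ≤ s → s - t ≤ C * (1 + Real.log (1 + (s + 1) / κ)) →
      s - t ≤ M * Real.log (t + 2) ∧ s + 1 ≤ M * (t + 2) := by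
  set A := Real.log (1 + 1 / κ) with hA
  have hA0 : 0 ≤ A := Real.log_nonneg (by simp [hκ.le])
  -- Chosen so that `C * log (s + 2)` is at most `(s + 2) / 2` plus a constant, and can be absorbed
  -- on the left.
  set D := 2 * (C + 1) with hD
  have hDpos : 0 < D := by positivity
  have hlD : 0 ≤ Real.log D := Real.log_nonneg (by linarith)
  set A2 := 2 * (C * (1 + A) + C * Real.log D + 1) with hA2
  have hA20 : 0 ≤ A2 := by positivity
  set A3 := 4 + A2 with hA3
  have hl3 : 0 ≤ Real.log A3 := Real.log_nonneg (by linarith)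
  have hl2 : 0 < Real.log 2 := Real.log_pos one_lt_two
  set M₁ := (C * (1 + A) + C * Real.log A3) / Real.log 2 + C with hM₁
  have hM₁0 : 0 ≤ M₁ := by positivity
  refine ⟨M₁ + A3, by positivity, fun t s ht hts h => ?_⟩
  have h1 : Real.log (1 + (s + 1) / κ) ≤ A + Real.log (s + 2) := by
    rw [hA, ← Real.log_mul (by positivity) (by linarith)]
    refine Real.log_le_log (by have : 0 < (s + 1) / κ := by { apply div_pos <;> linarith }
                               linarith) ?_
    have : 0 < 1 / κ := by positivity
    rw [div_eq_mul_one_div]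
    nlinarith
  have h2 : s - t ≤ C * (1 + A) + C * Real.log (s + 2) := by
    have := mul_le_mul_of_nonneg_left h1 hC
    linarith
  have h3 : C * Real.log (s + 2) ≤ (s + 2) / 2 + C * Real.log D := by
    have h4 : Real.log (s + 2) = Real.log ((s + 2) / D) + Real.log D := by
      rw [← Real.log_mul (div_pos (by linarith) hDpos).ne' hDpos.ne', div_mul_cancel₀ _ hDpos.ne']
    have h5 := Real.log_le_sub_one_of_pos (div_pos (by linarith : 0 < s + 2) hDpos)
    have h6 : C * ((s + 2) / D) ≤ (s + 2) / 2 := by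
      rw [hD, ← mul_div_assoc, div_le_div_iff₀ (by positivity) two_pos]
      nlinarith
    rw [h4]
    nlinarith
  have h7 : s + 2 ≤ A3 * (t + 2) := by nlinarith
  have h8 : Real.log (s + 2) ≤ Real.log A3 + Real.log (t + 2) := by
    rw [← Real.log_mul (by positivity) (by linarith)]
    exact Real.log_le_log (by linarith) h7
  have h9 : Real.log 2 ≤ Real.log (t + 2) := Real.log_le_log two_pos (by linarith)
  have h10 : C * (1 + A) + C * Real.log A3 ≤
      (C * (1 + A) + C * Real.log A3) / Real.log 2 * Real.log (t + 2) := by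
    rw [div_mul_eq_mul_div, le_div_iff₀ hl2]
    exact mul_le_mul_of_nonneg_left h9 (by positivity)
  constructor
  · have := mul_le_mul_of_nonneg_left h8 hC
    have : 0 ≤ A3 * Real.log (t + 2) := mul_nonneg (by positivity) (by linarith)
    rw [hM₁]
    nlinarith
  · nlinarith

/-- Divergence of `∑ 1 / (n log n)` in the form used here: a nonnegative non-increasing quantity
cannot lose `κ / (s + 1)` at times `s` separated by gaps of logarithmic length. -/
theorem false_of_logarithmic_losses {e : ℝ → ℝ} (he0 : ∀ t, 0 ≤ t → 0 ≤ e t)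
    (he : AntitoneOn e (Ici 0)) {h κ C T₀ : ℝ} (hh : 0 < h) (hκ : 0 < κ) (hC : 0 ≤ C)
    (hT₀ : 0 ≤ T₀)
    (hloss : ∀ t, T₀ ≤ t → ∃ s, t ≤ s ∧ s - t ≤ C * (1 + Real.log (1 + 1 / e s)) ∧
      e (s + h) + κ / (s + 1) ≤ e s) : False := by
  obtain ⟨M, hM, hMb⟩ := exists_log_mul_bound hC hκ
  have hl2 : 0 < Real.log 2 := Real.log_pos one_lt_two
  set M₂ := M + h / Real.log 2 with hM₂
  have hM₂0 : 0 < M₂ := by positivity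
  -- With this weight the quantity `log (log (t + 2)) + N * e t` does not increase from one loss to
  -- the next: the first term gains at most `M₂ / (t + 2)`, which the loss `κ / (s + 1)` outweighs.
  set N := M₂ * M / κ with hN
  have hN0 : 0 < N := by positivity
  have step : ∀ t, T₀ ≤ t → ∃ t', t + h ≤ t' ∧
      Real.log (Real.log (t' + 2)) + N * e t' ≤ Real.log (Real.log (t + 2)) + N * e t := by
    intro t ht
    have ht0 : 0 ≤ t := hT₀.trans ht
    obtain ⟨s, hts, hs1, hs2⟩ := hloss t ht
    have hs0 : 0 ≤ s := ht0.trans hts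
    refine ⟨s + h, by linarith, ?_⟩
    have hκs : 0 < κ / (s + 1) := by positivity
    -- There must be enough excess to pay for the loss; this turns a gap logarithmic in `1 / e s`
    -- into one logarithmic in `s`.
    have hes : κ / (s + 1) ≤ e s := by linarith [he0 (s + h) (by linarith)]
    have hlog : Real.log (1 + 1 / e s) ≤ Real.log (1 + (s + 1) / κ) := by
      refine Real.log_le_log (by have := hκs.trans_le hes; positivity) ?_
      have := one_div_le_one_div_of_le hκs hes
      rw [one_div_div] at this
      linarith
    obtain ⟨h1, h2⟩ := hMb t s ht0 hts (hs1.trans (by gcongr))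
    have hlt : Real.log 2 ≤ Real.log (t + 2) := Real.log_le_log two_pos (by linarith)
    have hlt0 : 0 < Real.log (t + 2) := hl2.trans_le hlt
    have h3 : s + h - t ≤ M₂ * Real.log (t + 2) := by
      have : h ≤ h / Real.log 2 * Real.log (t + 2) := by
        rw [div_mul_eq_mul_div, le_div_iff₀ hl2]
        exact mul_le_mul_of_nonneg_left hlt hh.le
      rw [hM₂]
      linarith
    have sub_log {p q : ℝ} (hp : 0 < p) (hq : 0 < q) :
        Real.log p - Real.log q ≤ (p - q) / q := by
      rw [← Real.log_div hp.ne' hq.ne', sub_div, div_self hq.ne']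
      exact Real.log_le_sub_one_of_pos (by positivity)
    have h4 := sub_log (by linarith : 0 < s + h + 2) (by linarith : 0 < t + 2)
    have h5 := sub_log (Real.log_pos (by linarith : 1 < s + h + 2)) hlt0
    have h6 : Real.log (Real.log (s + h + 2)) - Real.log (Real.log (t + 2)) ≤ M₂ / (t + 2) := by
      refine h5.trans ?_
      rw [div_le_iff₀ hlt0]
      refine h4.trans ?_
      rw [div_mul_eq_mul_div]
      gcongr
      linarith
    have h7 : M₂ / (t + 2) ≤ N * (κ / (s + 1)) := by
      have : N * (κ / (s + 1)) = M₂ * M / (s + 1) := by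
        rw [hN]; field_simp
      rw [this, div_le_div_iff₀ (by linarith) (by linarith), mul_assoc]
      exact mul_le_mul_of_nonneg_left h2 hM₂0.le
    have h8 : e s ≤ e t := he (mem_Ici.2 ht0) (mem_Ici.2 hs0) hts
    nlinarith
  have iter : ∀ n : ℕ, ∃ t, T₀ + n * h ≤ t ∧
      Real.log (Real.log (t + 2)) + N * e t ≤ Real.log (Real.log (T₀ + 2)) + N * e T₀ := by
    intro n
    induction n with
    | zero => exact ⟨T₀, by simp, le_rfl⟩
    | succ n ih =>
      obtain ⟨t, ht, hQ⟩ := ih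
      have hn : 0 ≤ (n : ℝ) * h := by positivity
      obtain ⟨t', ht', hQ'⟩ := step t (by linarith)
      exact ⟨t', by push_cast; linarith, hQ'.trans hQ⟩
  have hlim : Tendsto (fun t : ℝ => Real.log (Real.log (t + 2))) atTop atTop :=
    Real.tendsto_log_atTop.comp (Real.tendsto_log_atTop.comp
      (tendsto_atTop_add_const_right _ _ tendsto_id))
  obtain ⟨T, hT⟩ := eventually_atTop.1
    (hlim.eventually_gt_atTop (Real.log (Real.log (T₀ + 2)) + N * e T₀))
  obtain ⟨n, hn⟩ := exists_nat_gt ((T - T₀) / h)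
  rw [div_lt_iff₀ hh] at hn
  obtain ⟨t, ht, hQ⟩ := iter n
  have hn0 : 0 ≤ (n : ℝ) * h := by positivity
  have h1 := hT t (by linarith)
  have h2 := mul_nonneg hN0.le (he0 t (by linarith))
  linarith

/-! ### Energy loss at fast moments and length of slow phases. -/

section Asymptotics

variable {a G x v : ℝ → ℝ}

theorem IsTraj.exists_tendsto_energy (h : DampedSystem a G) (hT : IsTraj a G x v) :
    ∃ e, Tendsto (energy G x v) atTop (𝓝 e) ∧ ∀ t, 0 ≤ t → e ≤ energy G x v t := by
  obtain ⟨m, hm⟩ := h.exists_lower_bound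
  have hanti := hT.energy_antitoneOn h
  have hA : Antitone fun t => energy G x v (max t 0) := fun s t hst =>
    hanti (mem_Ici.2 (le_max_right _ _)) (mem_Ici.2 (le_max_right _ _)) (max_le_max_right 0 hst)
  have hB : BddBelow (range fun t => energy G x v (max t 0)) := by
    refine ⟨m, ?_⟩
    rintro _ ⟨t, rfl⟩
    have := sq_nonneg (v (max t 0))
    have := hm (x (max t 0))
    simp only [energy]
    linarith
  have hlim := tendsto_atTop_ciInf hA hB
  refine ⟨_, hlim.congr' ?_, fun t ht => ?_⟩
  · filter_upwards [eventually_ge_atTop 0] with t ht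
    rw [max_eq_left ht]
  · simpa [max_eq_left ht] using ciInf_le hB t

theorem IsTraj.exists_bounds (h : DampedSystem a G) (hT : IsTraj a G x v) :
    ∃ R > 0, ∃ B > 0, ∀ t, 0 ≤ t → |x t| ≤ R ∧ |v t| ≤ R ∧
      |-(a t * v t) - deriv G (x t)| ≤ B := by
  obtain ⟨R, hR, hbox⟩ := h.exists_box (energy G x v 0)
  obtain ⟨B, hB⟩ := isCompact_Icc.exists_bound_of_continuousOn (s := Icc (-R) R)
    h.continuous_deriv.continuousOn
  have ha0 := h.nonneg 0 le_rfl
  have hB0 : 0 ≤ B := (norm_nonneg _).trans (hB 0 ⟨by linarith, hR.le⟩)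
  refine ⟨R, hR, a 0 * R + B + 1, by positivity, fun t ht => ?_⟩
  obtain ⟨h1, h2⟩ := hbox _ _ (hT.energy_le h ht)
  refine ⟨h1.le, h2.le, ?_⟩
  have h3 : |a t * v t| ≤ a 0 * R := by
    rw [abs_mul, abs_of_nonneg (h.nonneg t ht)]
    exact mul_le_mul (h.anti (mem_Ici.2 le_rfl) (mem_Ici.2 ht) ht) h2.le (abs_nonneg _) ha0
  have h4 := hB (x t) (abs_le.1 h1.le)
  rw [Real.norm_eq_abs] at h4
  have h5 := abs_sub (-(a t * v t)) (deriv G (x t))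
  rw [abs_neg] at h5
  linarith

/-- On `[t, t + 1]` the mean value theorem gives a time `ξ` where the acceleration equals the small
number `v (t + 1) - v t`. Friction is small at `ξ`, and the position has hardly moved, so the force
at `t` is small too. -/
theorem IsTraj.tendsto_deriv_comp (h : DampedSystem a G) (hT : IsTraj a G x v)
    (hv : Tendsto v atTop (𝓝 0)) : Tendsto (fun t => deriv G (x t)) atTop (𝓝 0) := by
  obtain ⟨R, hR, B, -, hb⟩ := hT.exists_bounds h
  obtain ⟨K, hK⟩ := h.lip (Icc (-R) R) (Metric.isBounded_Icc _ _)
  have ha0 := h.nonneg 0 le_rfl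
  have hK0 : (0 : ℝ) ≤ K := K.2
  rw [Metric.tendsto_atTop] at hv ⊢
  intro ε hε
  set η := ε / (3 + a 0 + K) with hη
  have hη0 : 0 < η := by positivity
  have hηε : η * (3 + a 0 + K) = ε := div_mul_cancel₀ _ (by positivity)
  obtain ⟨T, hT'⟩ := hv η hη0
  refine ⟨max T 1, fun t ht => ?_⟩
  have htT : T ≤ t := (le_max_left _ _).trans ht
  have ht1 : 1 ≤ t := (le_max_right _ _).trans ht
  have hvs : ∀ s, t ≤ s → |v s| < η := fun s hs => by simpa using hT' s (htT.trans hs)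
  obtain ⟨ξ, hξ, h1⟩ := exists_sub_eq_mul_of_hasDerivAt (lt_add_one t)
    (fun r hr => hT.hasDerivAt_snd (by linarith [hr.1]))
  obtain ⟨ζ, hζ, h2⟩ := exists_sub_eq_mul_of_hasDerivAt hξ.1
    (fun r hr => hT.hasDerivAt_fst (t := r) (by linarith [hr.1]))
  have hξ0 : 0 ≤ ξ := by linarith [hξ.1]
  have h3 : |deriv G (x ξ) - deriv G (x t)| ≤ K * |x ξ - x t| := by
    simpa [Real.dist_eq] using hK.dist_le_mul _ (abs_le.1 (hb ξ hξ0).1) _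
      (abs_le.1 (hb t (by linarith)).1)
  have h4 : |x ξ - x t| ≤ η := by
    rw [h2, abs_mul, abs_of_pos (sub_pos.2 hξ.1)]
    have := hvs ζ hζ.1.le
    have := abs_nonneg (v ζ)
    nlinarith [hξ.1, hξ.2]
  have h5 : |a ξ * v ξ| ≤ a 0 * η := by
    rw [abs_mul, abs_of_nonneg (h.nonneg ξ hξ0)]
    exact mul_le_mul (h.anti (mem_Ici.2 le_rfl) (mem_Ici.2 hξ0) hξ0) (hvs ξ hξ.1.le).le
      (abs_nonneg _) ha0
  have h6 := mul_le_mul_of_nonneg_left h4 hK0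
  have h7 := hvs t le_rfl
  have h8 := hvs (t + 1) (by linarith)
  have h9 : deriv G (x t) = -(deriv G (x ξ) - deriv G (x t)) - a ξ * v ξ - (v (t + 1) - v t) := by
    rw [h1]; ring
  rw [Real.dist_eq, sub_zero, ← hηε]
  rw [abs_lt] at h7 h8 ⊢
  rw [abs_le] at h3 h5
  constructor <;> linarith

theorem MapClusterPt.eq_of_tendsto {X Y : Type*} [TopologicalSpace Y] [T2Space Y] {F : Filter X}
    {f : X → Y} {c d : Y} (hc : MapClusterPt c F f) (hd : Tendsto f F (𝓝 d)) : c = d := by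
  obtain ⟨U, hU, h⟩ := mapClusterPt_iff_ultrafilter.1 hc
  exact tendsto_nhds_unique h (hd.mono_left hU)

/-- Every cluster point of the bounded curve `x` is critical at the limiting energy level, and
injectivity of `G` on critical points leaves only one. -/
theorem IsTraj.exists_tendsto_of_tendsto_velocity (h : DampedSystem a G)
    (hinj : InjOn G {c | deriv G c = 0}) (hT : IsTraj a G x v) (hv : Tendsto v atTop (𝓝 0)) :
    ∃ c, deriv G c = 0 ∧ Tendsto x atTop (𝓝 c) := by
  obtain ⟨R, hR, B, -, hb⟩ := hT.exists_bounds h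
  obtain ⟨e, he, -⟩ := hT.exists_tendsto_energy h
  have hG' := hT.tendsto_deriv_comp h hv
  have hG : Tendsto (G ∘ x) atTop (𝓝 e) := by
    have h1 : Tendsto (fun t => energy G x v t - v t ^ 2 / 2) atTop (𝓝 (e - 0 ^ 2 / 2)) :=
      he.sub ((hv.pow 2).div_const 2)
    simpa [energy, Function.comp_def] using h1
  have hmem : ∀ᶠ t in atTop, x t ∈ Icc (-R) R := by
    filter_upwards [eventually_ge_atTop 0] with t ht using abs_le.1 (hb t ht).1
  have hcl : ∀ c, MapClusterPt c atTop x → deriv G c = 0 ∧ G c = e := fun c hc =>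
    ⟨(hc.continuousAt_comp h.continuous_deriv.continuousAt).eq_of_tendsto hG',
      (hc.continuousAt_comp h.contDiff.continuous.continuousAt).eq_of_tendsto hG⟩
  obtain ⟨c, -, hc⟩ := (isCompact_Icc (a := -R) (b := R)).exists_mapClusterPt
    (tendsto_principal.2 hmem)
  refine ⟨c, (hcl c hc).1, isCompact_Icc.tendsto_nhds_of_unique_mapClusterPt hmem
    fun d _ hd => ?_⟩
  exact hinj (hcl d hd).1 (hcl c hc).1 ((hcl d hd).2.trans (hcl c hc).2.symm)

/-- A trajectory of low energy near a nondegenerate minimum stays near it. -/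
theorem IsTraj.abs_sub_lt_of_trapped (h : DampedSystem a G) (hT : IsTraj a G x v) {c ρ δ T : ℝ}
    (hc : ∀ y, |y - c| = ρ → G c + δ * ρ ^ 2 ≤ G y) (hT0 : 0 ≤ T) (hx : |x T - c| < ρ)
    (hE : energy G x v T < G c + δ * ρ ^ 2) : ∀ t, T ≤ t → |x t - c| < ρ := by
  intro t ht
  refine lt_of_forall_prefix_lt (g := fun t => |x t - c|) (a := T) (b := t) ?_ hx ?_ t ⟨ht, le_rfl⟩
  · exact ((hT.continuousOn_fst.sub continuousOn_const).abs).mono fun s hs => hT0.trans hs.1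
  · intro τ hτ hle
    refine lt_of_le_of_ne (hle τ ⟨hτ.1, le_rfl⟩) fun heq => ?_
    have h1 := hc _ heq
    have h2 : energy G x v τ ≤ energy G x v T :=
      hT.energy_antitoneOn h (mem_Ici.2 hT0) (mem_Ici.2 (hT0.trans hτ.1)) hτ.1
    have h3 : G (x τ) ≤ energy G x v τ := by
      simp only [energy]
      nlinarith [sq_nonneg (v τ)]
    linarith

/-- A fast moment is followed by a quantified loss of energy. -/
theorem IsTraj.exists_energy_loss (h : DampedSystem a G) (hT : IsTraj a G x v)
    (hlow : ∃ c > 0, ∀ t, 0 ≤ t → c / (t + 1) ≤ a t) {v₀ : ℝ} (hv₀ : 0 < v₀) :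
    ∃ τ > 0, ∃ κ > 0, ∀ s, 0 < s → v₀ ≤ |v s| →
      energy G x v (s + τ) + κ / (s + 1) ≤ energy G x v s := by
  obtain ⟨R, hR, B, hB, hb⟩ := hT.exists_bounds h
  obtain ⟨c, hc, hac⟩ := hlow
  -- As the acceleration is at most `B`, the speed stays at least `v₀ / 2` for time `τ`.
  set τ := v₀ / (2 * B) with hτ
  have hτ0 : 0 < τ := by positivity
  have hBτ : B * τ = v₀ / 2 := by
    rw [hτ]; field_simp
  -- The factor `1 + τ` replaces the damping bound at a time before `s + τ` by one at `s`: `s + τ +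
  -- 1 ≤ (1 + τ) * (s + 1)`.
  refine ⟨τ, hτ0, c * (v₀ ^ 2 / 4) * τ / (1 + τ), by positivity, fun s hs hvs => ?_⟩
  obtain ⟨ξ, hξ, h1⟩ := exists_sub_eq_mul_of_hasDerivAt (f := energy G x v)
    (f' := fun t => -(a t * v t ^ 2)) (lt_add_of_pos_right s hτ0) (fun r hr => by
      have hr0 : 0 < r := hs.trans_le hr.1
      have := energy_hasDerivWithinAt h (s := univ) (hT.hasDerivAt_fst hr0).hasDerivWithinAt
        (hT.hasDerivAt_snd hr0).hasDerivWithinAt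
      exact hasDerivWithinAt_univ.1 this)
  have hξ0 : 0 < ξ := hs.trans hξ.1
  obtain ⟨ζ, hζ, h2⟩ := exists_sub_eq_mul_of_hasDerivAt hξ.1
    (fun r hr => hT.hasDerivAt_snd (t := r) (hs.trans_le hr.1))
  have h3 : |v ξ - v s| ≤ v₀ / 2 := by
    rw [h2, abs_mul, abs_of_pos (sub_pos.2 hξ.1), ← hBτ]
    exact mul_le_mul (hb ζ (hs.trans hζ.1).le).2.2 (by linarith [hξ.2])
      (by linarith [hξ.1]) hB.le
  have h4 : v₀ / 2 ≤ |v ξ| := by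
    have := abs_sub_abs_le_abs_sub (v s) (v ξ)
    rw [abs_sub_comm] at this
    linarith
  have h5 : v₀ ^ 2 / 4 ≤ v ξ ^ 2 := by
    rw [← sq_abs (v ξ)]
    nlinarith
  have h6 : c / ((1 + τ) * (s + 1)) ≤ a ξ := by
    refine le_trans ?_ (hac ξ hξ0.le)
    apply div_le_div_of_nonneg_left hc.le (by linarith)
    nlinarith [hξ.2]
  have h7 : c / ((1 + τ) * (s + 1)) * (v₀ ^ 2 / 4) ≤ a ξ * v ξ ^ 2 :=
    mul_le_mul h6 h5 (by positivity) (h.nonneg ξ hξ0.le)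
  have h8 : c * (v₀ ^ 2 / 4) * τ / (1 + τ) / (s + 1) =
      c / ((1 + τ) * (s + 1)) * (v₀ ^ 2 / 4) * τ := by
    field_simp
  have h9 := mul_le_mul_of_nonneg_right h7 hτ0.le
  have h10 : s + τ - s = τ := by ring
  rw [h10] at h1
  rw [h8]
  linarith

/-- If slow phases have length at most logarithmic in the inverse excess energy, then the
trajectory cannot be fast infinitely often. -/
theorem IsTraj.false_of_slow_phases (h : DampedSystem a G) (hT : IsTraj a G x v)
    (hlow : ∃ c > 0, ∀ t, 0 ≤ t → c / (t + 1) ≤ a t) {v₀ e C T₀ : ℝ} (hv₀ : 0 < v₀)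
    (he : ∀ t, 0 ≤ t → e ≤ energy G x v t) (hC : 0 ≤ C) (hT₀ : 0 < T₀)
    (hfast : ∀ T, ∃ s, T ≤ s ∧ v₀ ≤ |v s|)
    (hslow : ∀ t s, T₀ ≤ t → t ≤ s → (∀ r ∈ Icc t s, |v r| < v₀) → e < energy G x v s →
      s - t ≤ C * (1 + Real.log (1 + 1 / (energy G x v s - e)))) : False := by
  obtain ⟨τ, hτ, κ, hκ, hloss⟩ := hT.exists_energy_loss h hlow hv₀
  have hanti := hT.energy_antitoneOn h
  refine false_of_logarithmic_losses (e := fun t => energy G x v t - e)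
    (fun t ht => sub_nonneg.2 (he t ht))
    (fun s hs t ht hst => sub_le_sub_right (hanti hs ht hst) e) hτ hκ hC hT₀.le
    fun t ht => ?_
  have ht0 : 0 < t := hT₀.trans_le ht
  set S := {s | t ≤ s ∧ v₀ ≤ |v s|} with hS
  have hScl : IsClosed S :=
    (hT.continuousOn_snd.abs.mono fun s hs => mem_Ici.2 (ht0.le.trans hs)).preimage_isClosed_of_isClosed
      isClosed_Ici (isClosed_Ici (a := v₀))
  have hbdd : BddBelow S := ⟨t, fun s hs => hs.1⟩
  have hmem : sInf S ∈ S := hScl.csInf_mem (hfast t) hbdd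
  set s := sInf S with hs
  have hs0 : 0 < s := ht0.trans_le hmem.1
  have hl := hloss s hs0 hmem.2
  have hκs : 0 < κ / (s + 1) := by positivity
  have hes : 0 < energy G x v s - e := by linarith [he (s + τ) (by linarith)]
  have hlog : 0 ≤ Real.log (1 + 1 / (energy G x v s - e)) :=
    Real.log_nonneg (by simp [hes.le])
  refine ⟨s, hmem.1, ?_, by linarith⟩
  -- `s` is the first fast time after `t` and is not itself slow, so the slow-phase bound is applied
  -- up to `t + s'`, slightly earlier; the excess energy is larger there, which only helps.
  by_contra! hcon
  obtain ⟨s', h1, h2⟩ := exists_between hcon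
  have hs't : t < t + s' := by
    have : 0 ≤ C * (1 + Real.log (1 + 1 / (energy G x v s - e))) := by positivity
    linarith
  have h3 := hslow t (t + s') ht hs't.le (fun r hr => by
    by_contra! hr'
    have := csInf_le hbdd (show r ∈ S from ⟨hr.1, hr'⟩)
    linarith [hr.2])
  have h4 : energy G x v s ≤ energy G x v (t + s') :=
    hanti (mem_Ici.2 (by linarith)) (mem_Ici.2 hs0.le) (by linarith)
  have h5 := h3 (by linarith)
  have h6 : Real.log (1 + 1 / (energy G x v (t + s') - e)) ≤
      Real.log (1 + 1 / (energy G x v s - e)) := by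
    have h7 : 0 < energy G x v (t + s') - e := by linarith
    refine Real.log_le_log (by positivity) ?_
    gcongr
  have := mul_le_mul_of_nonneg_left (add_le_add_right h6 1) hC
  linarith

/-- Where the force is bounded below, slow phases are short. -/
theorem IsTraj.slow_phase_le (hT : IsTraj a G x v) {μ v₀ t s : ℝ} (hμ : 0 < μ) (hv₀ : 0 ≤ v₀)
    (ht : 0 < t) (hts : t ≤ s) (hv : ∀ r ∈ Icc t s, |v r| ≤ v₀)
    (ha : ∀ r ∈ Icc t s, |a r * v r| ≤ μ / 2)
    (hG : ∀ r ∈ Icc t s, μ ≤ |deriv G (x r)|) : s - t ≤ 2 * v₀ / (μ / 2) := by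
  refine sub_le_of_le_abs_deriv hts (by positivity) hv₀
    (fun r hr => hT.hasDerivAt_snd (ht.trans_le hr.1)) (fun r hr => ?_) hv
  have h1 := abs_sub_abs_le_abs_sub (deriv G (x r)) (-(a r * v r))
  rw [abs_sub_comm, abs_neg] at h1
  linarith [ha r hr, hG r hr]

/-- Near an energy level, points away from its critical points have nonzero force. -/
theorem DampedSystem.exists_force_bound (h : DampedSystem a G) (R e : ℝ) {N : Set ℝ}
    (hN : IsOpen N) (hcrit : ∀ y, deriv G y = 0 → G y = e → y ∈ N) :
    ∃ μ > 0, ∀ y, |y| ≤ R → y ∉ N → |G y - e| < μ → μ ≤ |deriv G y| := by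
  have hK : IsCompact (Icc (-R) R \ N) := isCompact_Icc.diff hN
  have hc := h.contDiff.continuous
  have hc' := h.continuous_deriv
  -- The sum vanishes only at critical points at level `e`, all of which lie in `N`.
  obtain ⟨m, hm, hb⟩ := hK.exists_forall_le' (f := fun y => |G y - e| + |deriv G y|) (a := 0)
    (by fun_prop) (fun y hy => by
      by_contra! hle
      have h1 := abs_nonneg (G y - e)
      have h2 := abs_nonneg (deriv G y)
      exact hy.2 (hcrit y (abs_eq_zero.1 (by linarith))
        (sub_eq_zero.1 (abs_eq_zero.1 (by linarith)))))
  refine ⟨m / 2, by positivity, fun y hy hyN hyG => ?_⟩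
  have := hb y ⟨abs_le.1 hy, hyN⟩
  linarith

end Asymptotics

/-! ### Convergence of every trajectory to a critical point. -/

theorem StronglyConvexNear.exists_quadratic_lower {G : ℝ → ℝ} {c : ℝ}
    (hG : StronglyConvexNear G c) (hc : deriv G c = 0) :
    ∃ ε > 0, ∃ δ > 0, ∀ y, |y - c| < ε → G c + δ * (y - c) ^ 2 ≤ G y := by
  obtain ⟨ε, hε, δ, hδ, h⟩ := hG
  refine ⟨ε, hε, δ, hδ, fun y hy => ?_⟩
  rw [abs_lt] at hy
  have := h c ⟨by linarith, by linarith⟩ y ⟨by linarith [hy.1], by linarith [hy.2]⟩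
  rw [hc] at this
  linarith

theorem StronglyConcaveNear.exists_quadratic_upper {G : ℝ → ℝ} {c : ℝ}
    (hG : StronglyConcaveNear G c) (hc : deriv G c = 0) :
    ∃ ε > 0, ∃ δ > 0, ∀ y, |y - c| < ε → G y ≤ G c - δ * (y - c) ^ 2 := by
  obtain ⟨ε, hε, δ, hδ, h⟩ := StronglyConvexNear.exists_quadratic_lower hG
    (by rw [deriv.fun_neg, hc, neg_zero])
  exact ⟨ε, hε, δ, hδ, fun y hy => by linarith [h y hy]⟩

section Convergence

variable {a G x v : ℝ → ℝ}

/-- At late slow times nearly all energy is potential, so `G (x r)` is close to `e`, and friction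
cannot offset a force of size `μ`. -/
theorem IsTraj.exists_slow_threshold (h : DampedSystem a G) (ha : Tendsto a atTop (𝓝 0)) {e : ℝ}
    (he : Tendsto (energy G x v) atTop (𝓝 e)) {μ v₁ : ℝ}
    (hμ : 0 < μ) (hv₁ : 0 < v₁) :
    ∃ v₀ > 0, v₀ ≤ v₁ ∧ ∃ T₀ > 0, ∀ r, T₀ ≤ r → |v r| < v₀ →
      |a r * v r| ≤ μ / 2 ∧ |G (x r) - e| < μ := by
  obtain ⟨T₁, hT₁⟩ := eventually_atTop.1 (ha.eventually_lt_const (half_pos hμ))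
  obtain ⟨T₂, hT₂⟩ := Metric.tendsto_atTop.1 he (μ / 2) (half_pos hμ)
  refine ⟨min v₁ (min μ 1), by positivity, min_le_left _ _, max 1 (max T₁ T₂), by positivity,
    fun r hr hvr => ?_⟩
  simp only [max_le_iff] at hr
  have hr0 : 0 ≤ r := by linarith [hr.1]
  have h1 := hT₁ r hr.2.1
  have h2 := hT₂ r hr.2.2
  simp only [lt_min_iff] at hvr
  have h0 := abs_nonneg (v r)
  constructor
  · rw [abs_mul, abs_of_nonneg (h.nonneg r hr0)]
    nlinarith [h.nonneg r hr0]
  · rw [Real.dist_eq, abs_lt] at h2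
    simp only [energy] at h2
    have h3 : v r ^ 2 < μ := by
      rw [← sq_abs]
      nlinarith
    rw [abs_lt]
    constructor <;> linarith [h2.1, h2.2, sq_nonneg (v r)]

/-- Outside `N` the force has a lower bound at slow times, so slow phases have bounded length,
better than the logarithmic bound required. -/
theorem IsTraj.false_of_eventually_notMem (h : DampedSystem a G) (ha : Tendsto a atTop (𝓝 0))
    (hlow : ∃ c > 0, ∀ t, 0 ≤ t → c / (t + 1) ≤ a t) (hT : IsTraj a G x v) {e v₁ T₁ : ℝ}
    (he : Tendsto (energy G x v) atTop (𝓝 e)) (he' : ∀ t, 0 ≤ t → e ≤ energy G x v t)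
    (hv₁ : 0 < v₁) (hfast : ∀ T, ∃ s, T ≤ s ∧ v₁ ≤ |v s|) {N : Set ℝ} (hN : IsOpen N)
    (hcrit : ∀ y, deriv G y = 0 → G y = e → y ∈ N) (hout : ∀ t, T₁ ≤ t → x t ∉ N) : False := by
  obtain ⟨R, hR, B, hB, hb⟩ := hT.exists_bounds h
  obtain ⟨μ, hμ, hforce⟩ := h.exists_force_bound R e hN hcrit
  obtain ⟨v₀, hv₀, hv₀₁, T₀, hT₀, hslow⟩ := exists_slow_threshold h ha he hμ hv₁
  refine hT.false_of_slow_phases h hlow (C := 2 * v₀ / (μ / 2)) (T₀ := max T₀ T₁) hv₀ he'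
    (by positivity) (by positivity)
    (fun T => (hfast T).imp fun s hs => ⟨hs.1, hv₀₁.trans hs.2⟩) fun t s ht hts hv hes => ?_
  rw [max_le_iff] at ht
  have hlog : 0 ≤ Real.log (1 + 1 / (energy G x v s - e)) :=
    Real.log_nonneg (by simp [hes.le])
  refine (hT.slow_phase_le hμ hv₀.le (hT₀.trans_le ht.1) hts (fun r hr => (hv r hr).le)
    (fun r hr => (hslow r (ht.1.trans hr.1) (hv r hr)).1) fun r hr => ?_).trans ?_
  · exact hforce _ (hb r (hT₀.le.trans (ht.1.trans hr.1))).1 (hout r (ht.2.trans hr.1))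
      (hslow r (ht.1.trans hr.1) (hv r hr)).2
  · exact le_mul_of_one_le_right (by positivity) (by linarith)

theorem IsTraj.false_of_saddle (h : DampedSystem a G) (ha : Tendsto a atTop (𝓝 0))
    (hlow : ∃ c > 0, ∀ t, 0 ≤ t → c / (t + 1) ≤ a t) (hT : IsTraj a G x v) {c v₁ : ℝ}
    (he : Tendsto (energy G x v) atTop (𝓝 (G c)))
    (he' : ∀ t, 0 ≤ t → G c ≤ energy G x v t)
    (hv₁ : 0 < v₁) (hfast : ∀ T, ∃ s, T ≤ s ∧ v₁ ≤ |v s|)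
    (hcrit : ∀ y, deriv G y = 0 → G y = G c → y = c) {ρ δ : ℝ} (hρ : 0 < ρ) (hδ : 0 < δ)
    (hconc : ∀ y, |y - c| ≤ ρ → G y ≤ G c - δ * (y - c) ^ 2) : False := by
  obtain ⟨R, hR, B, hB, hb⟩ := hT.exists_bounds h
  obtain ⟨μ, hμ, hforce⟩ := h.exists_force_bound R (G c) (N := {y | |y - c| < ρ})
    (isOpen_lt (by fun_prop) (by fun_prop)) (fun y h1 h2 => by simp [hcrit y h1 h2, hρ])
  obtain ⟨v₀, hv₀, hv₀₁, T₀, hT₀, hslow⟩ := exists_slow_threshold h ha he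
    (lt_min hμ (by positivity : 0 < δ * ρ ^ 2)) hv₁
  obtain ⟨C, hC, hlog⟩ := exists_log_bound hδ hρ
  refine hT.false_of_slow_phases h hlow (C := C + 2 * v₀ / (μ / 2)) hv₀ he'
    (by positivity) hT₀
    (fun T => (hfast T).imp fun s hs => ⟨hs.1, hv₀₁.trans hs.2⟩) fun t s ht hts hv hes => ?_
  have ht0 : 0 < t := hT₀.trans_le ht
  have hlog0 : 0 ≤ Real.log (1 + 1 / (energy G x v s - G c)) :=
    Real.log_nonneg (by simp [hes.le])
  have hC' : 0 ≤ 2 * v₀ / (μ / 2) := by positivity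
  -- At distance `ρ` the potential is lower than `G c` by at least `δ * ρ ^ 2`, which is impossible
  -- at slow times. A slow phase is thus wholly inside or wholly outside.
  have hne : ∀ r ∈ Icc t s, |x r - c| ≠ ρ := by
    intro r hr heq
    have h1 := (hslow r (ht.trans hr.1) (hv r hr)).2.trans_le (min_le_right _ _)
    have h2 := hconc _ heq.le
    rw [← sq_abs, heq] at h2
    rw [abs_lt] at h1
    linarith [h1.1]
  have hcont : ContinuousOn (fun r => |x r - c|) (Icc t s) :=
    ((hT.continuousOn_fst.sub continuousOn_const).abs).mono fun r hr => ht0.le.trans hr.1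
  have hdich : (∀ r ∈ Icc t s, |x r - c| ≤ ρ) ∨ ∀ r ∈ Icc t s, ρ ≤ |x r - c| := by
    by_contra! hcon
    obtain ⟨⟨r₁, hr₁, h1⟩, r₂, hr₂, h2⟩ := hcon
    obtain ⟨r, hr, hrρ⟩ := isPreconnected_Icc.intermediate_value hr₂ hr₁ hcont ⟨h2.le, h1.le⟩
    exact hne r hr hrρ
  rcases hdich with hin | hout
  · refine (passage_time_le (y := fun r => x r - c) hts (sub_pos.2 hes) hδ hρ
      (fun r hr => (hT.hasDerivAt_fst (ht0.trans_le hr.1)).sub_const c) (fun r hr => ?_)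
      hin).trans ?_
    -- The excess at the end `s` bounds the excess throughout the phase from below.
    · have h1 : energy G x v s ≤ energy G x v r :=
        hT.energy_antitoneOn h (mem_Ici.2 (ht0.le.trans hr.1)) (mem_Ici.2 (ht0.le.trans hts)) hr.2
      have h2 := hconc _ (hin r hr)
      have h3 : energy G x v r = v r ^ 2 / 2 + G (x r) := rfl
      linarith
    · refine (hlog _ (sub_pos.2 hes)).trans ?_
      exact mul_le_mul_of_nonneg_right (by linarith) (by linarith)
  · refine (hT.slow_phase_le hμ hv₀.le ht0 hts (fun r hr => (hv r hr).le)
      (fun r hr => ?_) fun r hr => ?_).trans ?_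
    · refine (hslow r (ht.trans hr.1) (hv r hr)).1.trans ?_
      linarith [min_le_left μ (δ * ρ ^ 2)]
    · exact hforce _ (hb r (ht0.le.trans hr.1)).1 (not_lt.2 (hout r hr))
        ((hslow r (ht.trans hr.1) (hv r hr)).2.trans_le (min_le_left _ _))
    · have := mul_nonneg hC hlog0
      have := mul_nonneg hC' hlog0
      linarith

/-- At most one critical point lies at the limiting level. If it is strongly convex, late entry into
its well would trap the trajectory, and energy tending to the bottom would force `v → 0`; so the
well is eventually avoided and the case without critical points applies. -/
theorem IsTraj.tendsto_velocity (h : DampedSystem a G) (ha : Tendsto a atTop (𝓝 0))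
    (hlow : ∃ c > 0, ∀ t, 0 ≤ t → c / (t + 1) ≤ a t)
    (hinj : InjOn G {c | deriv G c = 0})
    (hconv : ∀ c, deriv G c = 0 → StronglyConvexNear G c ∨ StronglyConcaveNear G c)
    (hT : IsTraj a G x v) : Tendsto v atTop (𝓝 0) := by
  by_contra hv
  rw [Metric.tendsto_atTop] at hv
  push Not at hv
  obtain ⟨v₁, hv₁, hfast⟩ := hv
  simp only [Real.dist_eq, sub_zero] at hfast
  obtain ⟨e, he, he'⟩ := hT.exists_tendsto_energy h
  by_cases hex : ∃ c, deriv G c = 0 ∧ G c = e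
  swap
  · exact hT.false_of_eventually_notMem h ha hlow (T₁ := 0) he he' hv₁ hfast isOpen_empty
      (fun y h1 h2 => hex ⟨y, h1, h2⟩) (fun _ _ => id)
  obtain ⟨c, hc, rfl⟩ := hex
  have huniq : ∀ y, deriv G y = 0 → G y = G c → y = c := fun y h1 h2 => hinj h1 hc h2
  rcases hconv c hc with hcv | hcc
  · obtain ⟨ε, hε, δ, hδ, hq⟩ := hcv.exists_quadratic_lower hc
    refine hT.false_of_eventually_notMem h ha hlow (N := {y | |y - c| < ε / 2}) he he' hv₁ hfast
      (isOpen_lt (by fun_prop) (by fun_prop)) (fun y h1 h2 => by simp [huniq y h1 h2, hε])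
      (T₁ := ?_) ?_
    · exact max 0 (eventually_atTop.1 (he.eventually_lt_const
        (lt_add_of_pos_right (G c) (by positivity : 0 < δ * (ε / 2) ^ 2)))).choose
    intro T hTT hx
    rw [max_le_iff] at hTT
    have hE := (eventually_atTop.1 (he.eventually_lt_const
        (lt_add_of_pos_right (G c) (by positivity : 0 < δ * (ε / 2) ^ 2)))).choose_spec T hTT.2
    have htrap := hT.abs_sub_lt_of_trapped h (c := c) (δ := δ) (fun y hy => by
      rw [← hy, sq_abs]
      exact hq y (by linarith)) hTT.1 hx hE
    obtain ⟨T₂, hT₂⟩ := eventually_atTop.1 (he.eventually_lt_const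
      (lt_add_of_pos_right (G c) (by positivity : 0 < v₁ ^ 2 / 2)))
    obtain ⟨s, hs, hvs⟩ := hfast (max T T₂)
    rw [ge_iff_le, max_le_iff] at hs
    have h1 := hT₂ s hs.2
    have h2 := hq (x s) ((htrap s hs.1).trans (by linarith))
    have h3 : energy G x v s = v s ^ 2 / 2 + G (x s) := rfl
    have h4 : v₁ ^ 2 ≤ v s ^ 2 := by
      rw [← sq_abs (v s)]
      gcongr
    have h5 : 0 ≤ δ * (x s - c) ^ 2 := by positivity
    linarith
  · obtain ⟨ε, hε, δ, hδ, hq⟩ := hcc.exists_quadratic_upper hc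
    exact hT.false_of_saddle h ha hlow he he' hv₁ hfast huniq (half_pos hε) hδ
      fun y hy => hq y (by linarith)

theorem IsTraj.exists_tendsto (h : DampedSystem a G) (ha : Tendsto a atTop (𝓝 0))
    (hlow : ∃ c > 0, ∀ t, 0 ≤ t → c / (t + 1) ≤ a t)
    (hinj : InjOn G {c | deriv G c = 0})
    (hconv : ∀ c, deriv G c = 0 → StronglyConvexNear G c ∨ StronglyConcaveNear G c)
    (hT : IsTraj a G x v) :
    ∃ c, deriv G c = 0 ∧ Tendsto x atTop (𝓝 c) ∧ Tendsto v atTop (𝓝 0) := by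
  have hv := hT.tendsto_velocity h ha hlow hinj hconv
  obtain ⟨c, hc, hx⟩ := hT.exists_tendsto_of_tendsto_velocity h hinj hv
  exact ⟨c, hc, hx, hv⟩

end Convergence

/-! ### Openness and density of the good data. -/

theorem StronglyConvexNear.mul_sub_le {G : ℝ → ℝ} {ε δ c : ℝ}
    (h : ∀ x ∈ Ioo (c - ε) (c + ε), ∀ y ∈ Ioo (c - ε) (c + ε),
      G x + (y - x) * deriv G x + δ * (y - x) ^ 2 ≤ G y) {x y : ℝ}
    (hx : |x - c| < ε) (hy : |y - c| < ε) :
    2 * δ * (y - x) ^ 2 ≤ (deriv G y - deriv G x) * (y - x) := by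
  rw [abs_lt] at hx hy
  have hx' : x ∈ Ioo (c - ε) (c + ε) := ⟨by linarith [hx.1], by linarith [hx.2]⟩
  have hy' : y ∈ Ioo (c - ε) (c + ε) := ⟨by linarith [hy.1], by linarith [hy.2]⟩
  -- Adding the inequality to its copy with `x` and `y` exchanged cancels the values of `G`.
  linarith [h x hx' y hy', h y hy' x hx']

theorem StronglyConvexNear.exists_monotone {G : ℝ → ℝ} {c : ℝ} (hG : StronglyConvexNear G c) :
    ∃ ε > 0, ∃ δ > 0, ∀ x y, |x - c| < ε → |y - c| < ε →
      2 * δ * (y - x) ^ 2 ≤ (deriv G y - deriv G x) * (y - x) := by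
  obtain ⟨ε, hε, δ, hδ, h⟩ := hG
  exact ⟨ε, hε, δ, hδ, fun x y hx hy => StronglyConvexNear.mul_sub_le h hx hy⟩

theorem StronglyConcaveNear.exists_antitone {G : ℝ → ℝ} {c : ℝ} (hG : StronglyConcaveNear G c) :
    ∃ ε > 0, ∃ δ > 0, ∀ x y, |x - c| < ε → |y - c| < ε →
      (deriv G y - deriv G x) * (y - x) ≤ -(2 * δ * (y - x) ^ 2) := by
  obtain ⟨ε, hε, δ, hδ, h⟩ := StronglyConvexNear.exists_monotone hG
  refine ⟨ε, hε, δ, hδ, fun x y hx hy => ?_⟩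
  have := h x y hx hy
  rw [deriv.fun_neg, deriv.fun_neg] at this
  linarith

theorem StronglyConvexNear.isLocalMin {G : ℝ → ℝ} {c : ℝ} (hG : StronglyConvexNear G c)
    (hc : deriv G c = 0) : IsLocalMin G c := by
  obtain ⟨ε, hε, δ, hδ, h⟩ := hG.exists_quadratic_lower hc
  filter_upwards [Metric.ball_mem_nhds c hε] with y hy
  have : 0 ≤ δ * (y - c) ^ 2 := by positivity
  linarith [h y (by simpa [Real.dist_eq] using hy)]

theorem StronglyConcaveNear.not_isLocalMin {G : ℝ → ℝ} {c : ℝ} (hG : StronglyConcaveNear G c)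
    (hc : deriv G c = 0) : ¬IsLocalMin G c := by
  intro hmin
  obtain ⟨ε, hε, δ, hδ, h⟩ := hG.exists_quadratic_upper hc
  have hev : ∀ᶠ y in 𝓝[≠] c, False := by
    filter_upwards [nhdsWithin_le_nhds (Metric.ball_mem_nhds c hε), nhdsWithin_le_nhds hmin,
      self_mem_nhdsWithin] with y hy hy' hne
    have h1 := h y (by simpa [Real.dist_eq] using hy)
    have h2 : 0 < (y - c) ^ 2 := by
      have : y - c ≠ 0 := sub_ne_zero.2 hne
      positivity
    have h3 : G c ≤ G y := hy'
    nlinarith [mul_pos hδ h2]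
  exact hev.exists.choose_spec

section Genericity

variable {a G : ℝ → ℝ} {X V : ℝ × ℝ → ℝ → ℝ}

/-- Two trajectories whose difference of positions and difference of velocities have the same
positive value at some time cannot both stay forever where `G'` is strongly decreasing. -/
theorem IsTraj.false_of_separated {x v y u : ℝ → ℝ} (hT : IsTraj a G x v)
    (hT' : IsTraj a G y u) {c ρ ε δ T s : ℝ} (hρε : ρ < ε)
    (hconc : ∀ x y, |x - c| < ε → |y - c| < ε →
      (deriv G y - deriv G x) * (y - x) ≤ -(2 * δ * (y - x) ^ 2))
    (hT0 : 0 < T) (ha : ∀ t, T ≤ t → a t * a t ≤ 4 * δ) (hs : 0 < s)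
    (hx : ∀ t, T ≤ t → |x t - c| ≤ ρ) (hy : ∀ t, T ≤ t → |y t - c| ≤ ρ)
    (h1 : y T - x T = s) (h2 : u T - v T = s) : False := by
  have hz : ∀ t ∈ Ici T, HasDerivAt (fun t => y t - x t) (u t - v t) t := fun t ht =>
    (hT'.hasDerivAt_fst (hT0.trans_le ht)).sub (hT.hasDerivAt_fst (hT0.trans_le ht))
  have hb : ∀ t ∈ Ici T, HasDerivAt (fun t => (y t - x t) * (u t - v t)) _ t := fun t ht =>
    (hz t ht).mul ((hT'.hasDerivAt_snd (hT0.trans_le ht)).sub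
      (hT.hasDerivAt_snd (hT0.trans_le ht)))
  -- With `z = y - x`, the derivative of `z * z'` is at least `z' ^ 2 - a * z * z' + 2 * δ * z ^ 2`,
  -- which is nonnegative after completing the square because `a ^ 2 ≤ 4 * δ`.
  have hmono : MonotoneOn (fun t => (y t - x t) * (u t - v t)) (Ici T) := by
    refine monotoneOn_of_hasDerivWithinAt_nonneg (convex_Ici T)
      (fun t ht => (hb t ht).continuousAt.continuousWithinAt)
      (fun t ht => (hb t (interior_subset ht)).hasDerivWithinAt) fun t ht => ?_
    have ht' : T ≤ t := interior_subset ht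
    have h3 := hconc (x t) (y t) ((hx t ht').trans_lt hρε) ((hy t ht').trans_lt hρε)
    have h4 := mul_le_mul_of_nonneg_right (ha t ht') (sq_nonneg (y t - x t))
    nlinarith [sq_nonneg (u t - v t - a t * (y t - x t) / 2),
      mul_nonneg (mul_self_nonneg (a t)) (sq_nonneg (y t - x t))]
  have hbs : ∀ t ∈ Ici T, s ^ 2 ≤ (y t - x t) * (u t - v t) := by
    intro t ht
    have := hmono (mem_Ici.2 le_rfl) ht ht
    simp only [h1, h2] at this
    linarith
  have hsq : ∀ t ∈ Ici T, HasDerivAt (fun t => (y t - x t) ^ 2 - 2 * s ^ 2 * t) _ t := fun t ht =>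
    ((hz t ht).pow 2).sub ((hasDerivAt_id t).const_mul (2 * s ^ 2))
  have hmono' : MonotoneOn (fun t => (y t - x t) ^ 2 - 2 * s ^ 2 * t) (Ici T) := by
    refine monotoneOn_of_hasDerivWithinAt_nonneg (convex_Ici T)
      (fun t ht => (hsq t ht).continuousAt.continuousWithinAt)
      (fun t ht => (hsq t (interior_subset ht)).hasDerivWithinAt) fun t ht => ?_
    have := hbs t (interior_subset ht)
    push_cast
    nlinarith
  -- `z ^ 2` grows at rate at least `2 * s ^ 2`, starting from `s ^ 2`; by this time it exceeds `(2
  -- * ρ) ^ 2`.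
  have hlt : T ≤ T + 2 * ρ ^ 2 / s ^ 2 := le_add_of_nonneg_right (by positivity)
  have h5 := hmono' (mem_Ici.2 le_rfl) (mem_Ici.2 hlt) hlt
  have h6 : 2 * s ^ 2 * (T + 2 * ρ ^ 2 / s ^ 2) = 2 * s ^ 2 * T + 4 * ρ ^ 2 := by
    field_simp
    ring
  have h7 := abs_le.1 (hx _ hlt)
  have h8 := abs_le.1 (hy _ hlt)
  simp only [h1, h6] at h5
  have h9 : 0 < s ^ 2 := by positivity
  nlinarith [sq_nonneg ρ, abs_nonneg (x T - c), hx T le_rfl]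

/-- The initial energy is continuous in the data, so data near `p` share an energy bound and one
Lipschitz estimate covers them. -/
theorem continuous_flow (h : DampedSystem a G) (hT : ∀ p, IsTraj a G (X p) (V p))
    (hX : ∀ p, X p 0 = p.1) (hV : ∀ p, V p 0 = p.2) {t : ℝ} (ht : 0 ≤ t) :
    Continuous fun p => (X p t, V p t) := by
  rw [continuous_iff_continuousAt]
  intro p
  have hcont : Continuous fun q : ℝ × ℝ => energy G (X q) (V q) 0 := by
    have := h.contDiff.continuous
    simp only [energy, hX, hV]
    fun_prop
  obtain ⟨K, hK⟩ := h.exists_dist_le (energy G (X p) (V p) 0 + 1)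
  rw [ContinuousAt, tendsto_iff_dist_tendsto_zero]
  have hlim : Tendsto (fun q => dist q p * Real.exp (K * t)) (𝓝 p) (𝓝 0) := by
    have : Continuous fun q => dist q p * Real.exp (K * t) := by fun_prop
    simpa using this.tendsto p
  refine squeeze_zero' (Eventually.of_forall fun _ => dist_nonneg) ?_ hlim
  filter_upwards [hcont.continuousAt.eventually_lt_const
    (lt_add_one (energy G (X p) (V p) 0))] with q hq
  simpa [hX, hV] using hK _ _ _ _ (hT q) (hT p) hq.le (by linarith) t ht

/-- Data whose trajectory stays near a strongly concave point form a closed set with empty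
interior. -/
theorem StronglyConcaveNear.exists_trapped_nowhere_dense (h : DampedSystem a G)
    (ha : Tendsto a atTop (𝓝 0)) (hT : ∀ p, IsTraj a G (X p) (V p))
    (hX : ∀ p, X p 0 = p.1) (hV : ∀ p, V p 0 = p.2) {c : ℝ} (hc : StronglyConcaveNear G c) :
    ∃ ρ > 0, ∃ T₀ : ℝ, ∀ T, T₀ ≤ T → IsClosed {p | ∀ t, T ≤ t → |X p t - c| ≤ ρ} ∧
      interior {p | ∀ t, T ≤ t → |X p t - c| ≤ ρ} = ∅ := by
  obtain ⟨ε, hε, δ, hδ, hconc⟩ := hc.exists_antitone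
  have ha2 : ∀ᶠ t in atTop, a t * a t < 4 * δ :=
    (ha.mul ha).eventually_lt_const (by linarith)
  obtain ⟨T₁, hT₁⟩ := eventually_atTop.1 ha2
  refine ⟨ε / 2, half_pos hε, max 1 T₁, fun T hTT => ?_⟩
  rw [max_le_iff] at hTT
  have hT0 : 0 < T := by linarith [hTT.1]
  constructor
  · simp only [ofPred_forall]
    refine isClosed_iInter fun t => isClosed_iInter fun ht => ?_
    have := (continuous_flow h hT hX hV (hT0.le.trans ht)).fst
    exact isClosed_le (by fun_prop) continuous_const
  · rw [eq_empty_iff_forall_notMem]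
    intro p hp
    obtain ⟨r, hr, hball⟩ := Metric.mem_nhds_iff.1 (mem_interior_iff_mem_nhds.1 hp)
    obtain ⟨η, hη, hthrough⟩ := (hT p).exists_isTraj_through h hT0.le hr
    -- The state at time `T` is moved diagonally, by equal positive amounts in position and
    -- velocity; openness of the time-`T` map yields data still in the set.
    obtain ⟨y, u, hT', hyu, hw⟩ := hthrough (X p T + η / 2, V p T + η / 2) (by
      simp [Prod.dist_eq, abs_of_pos hη]
      linarith)
    rw [Prod.mk.injEq] at hw
    have hmem : (y 0, u 0) ∈ {p | ∀ t, T ≤ t → |X p t - c| ≤ ε / 2} :=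
      hball (by simpa [hX, hV] using hyu)
    have hy : ∀ t, T ≤ t → |y t - c| ≤ ε / 2 := by
      intro t ht
      rw [(hT'.eq_of_initial_eq h (hT (y 0, u 0)) (by simp [hX]) (by simp [hV])
        (hT0.le.trans ht)).1]
      exact hmem t ht
    exact (hT p).false_of_separated hT' (half_lt_self hε) hconc hT0
      (fun t ht => (hT₁ t (hTT.2.trans ht)).le) (half_pos hη) (interior_subset hp) hy
      (by rw [hw.1]; ring) (by rw [hw.2]; ring)

theorem mem_dataConvergingToLocalMin_iff (h : DampedSystem a G)
    (hT : ∀ p, IsTraj a G (X p) (V p)) (hX : ∀ p, X p 0 = p.1) (hV : ∀ p, V p 0 = p.2)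
    {p : ℝ × ℝ} : p ∈ dataConvergingToLocalMin a G ↔
      ∃ m, IsLocalMin G m ∧ Tendsto (X p) atTop (𝓝 m) := by
  constructor
  · rintro ⟨x, hx, m, hm, hlim⟩
    refine ⟨m, hm, hlim.congr' ?_⟩
    filter_upwards [eventually_ge_atTop 0] with t ht
    exact (hx.isTraj.eq_of_initial_eq h (hT p) (by rw [hx.initial_position, hX])
      (by rw [hx.initial_velocity, hV]) ht).1
  · rintro ⟨m, hm, hlim⟩
    refine ⟨X p, ?_, m, hm, hlim⟩
    simpa [hX, hV] using (hT p).isSolutionFrom h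

theorem isOpen_dataConvergingToLocalMin (h : DampedSystem a G) (ha : Tendsto a atTop (𝓝 0))
    (hlow : ∃ c > 0, ∀ t, 0 ≤ t → c / (t + 1) ≤ a t) (hinj : InjOn G {c | deriv G c = 0})
    (hconv : ∀ c, deriv G c = 0 → StronglyConvexNear G c ∨ StronglyConcaveNear G c)
    (hT : ∀ p, IsTraj a G (X p) (V p)) (hX : ∀ p, X p 0 = p.1) (hV : ∀ p, V p 0 = p.2) :
    IsOpen (dataConvergingToLocalMin a G) := by
  rw [isOpen_iff_eventually]
  intro p hp
  rw [mem_dataConvergingToLocalMin_iff h hT hX hV] at hp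
  obtain ⟨m, hm, hlim⟩ := hp
  have hm' := hm.deriv_eq_zero
  have hcv : StronglyConvexNear G m :=
    (hconv m hm').resolve_right fun hcc => hcc.not_isLocalMin hm' hm
  obtain ⟨ε₁, hε₁, δ₁, hδ₁, hmon⟩ := hcv.exists_monotone
  obtain ⟨ε₂, hε₂, δ, hδ, hq⟩ := hcv.exists_quadratic_lower hm'
  set ρ := min ε₁ ε₂ / 2 with hρ
  have hρ0 : 0 < ρ := half_pos (lt_min hε₁ hε₂)
  have hρ1 : ρ < ε₁ := by linarith [min_le_left ε₁ ε₂]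
  have hρ2 : ρ < ε₂ := by linarith [min_le_right ε₁ ε₂]
  have hGc := h.contDiff.continuous
  have hE : Tendsto (energy G (X p) (V p)) atTop (𝓝 (G m)) := by
    have h1 := ((hT p).tendsto_velocity h ha hlow hinj hconv)
    have h2 := ((h1.pow 2).div_const 2).add ((hGc.tendsto m).comp hlim)
    simpa [Function.comp_def] using h2.congr fun t => (rfl : _ = energy G (X p) (V p) t)
  have hclose : ∀ᶠ t in atTop, |X p t - m| < ρ := by
    simpa [Real.dist_eq] using hlim.eventually (Metric.ball_mem_nhds m hρ0)
  obtain ⟨T, hT0, hT1, hT2⟩ := ((eventually_ge_atTop 0).and (hclose.and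
    (hE.eventually_lt_const (lt_add_of_pos_right (G m) (by positivity : 0 < δ * ρ ^ 2))))).exists
  have hflow := continuous_flow h hT hX hV hT0
  have c1 : Continuous fun q => |X q T - m| := by
    have := hflow.fst
    fun_prop
  have c2 : Continuous fun q => energy G (X q) (V q) T := by
    have := hflow.fst
    have := hflow.snd
    unfold energy
    fun_prop
  filter_upwards [c1.continuousAt.eventually_lt_const hT1,
    c2.continuousAt.eventually_lt_const hT2] with q hq1 hq2
  rw [mem_dataConvergingToLocalMin_iff h hT hX hV]
  have htrap := (hT q).abs_sub_lt_of_trapped h (c := m) (δ := δ) (fun y hy => by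
    rw [← hy, sq_abs]
    exact hq y (by linarith)) hT0 hq1 hq2
  obtain ⟨c, hc, hcl, -⟩ := (hT q).exists_tendsto h ha hlow hinj hconv
  have hcm : |c - m| ≤ ρ := by
    refine le_of_tendsto (hcl.sub_const m).abs ?_
    filter_upwards [eventually_ge_atTop T] with t ht using (htrap t ht).le
  -- Strong monotonicity of the derivative leaves `m` as the only critical point in the well.
  have hcm' := hmon m c (by simpa using hε₁) (by linarith)
  rw [hc, hm', sub_zero, zero_mul] at hcm'
  have : (c - m) ^ 2 = 0 := le_antisymm (by nlinarith) (sq_nonneg _)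
  have : c = m := by
    rw [sq_eq_zero_iff] at this
    linarith
  exact ⟨m, hm, this ▸ hcl⟩

theorem dense_dataConvergingToLocalMin (h : DampedSystem a G) (ha : Tendsto a atTop (𝓝 0))
    (hlow : ∃ c > 0, ∀ t, 0 ≤ t → c / (t + 1) ≤ a t)
    (hfin : {c | deriv G c = 0}.Finite) (hinj : InjOn G {c | deriv G c = 0})
    (hconv : ∀ c, deriv G c = 0 → StronglyConvexNear G c ∨ StronglyConcaveNear G c)
    (hT : ∀ p, IsTraj a G (X p) (V p)) (hX : ∀ p, X p 0 = p.1) (hV : ∀ p, V p 0 = p.2) :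
    Dense (dataConvergingToLocalMin a G) := by
  set S := {c | deriv G c = 0 ∧ StronglyConcaveNear G c} with hS
  have : Countable S := (hfin.subset fun c hc => hc.1).countable.to_subtype
  choose ρ hρ T₀ hF using fun c : S => c.2.2.exists_trapped_nowhere_dense h ha hT hX hV
  -- Countably many sets suffice: enlarging the starting time enlarges the set, so integer offsets
  -- from `T₀` exhaust all cases.
  set F : S × ℕ → Set (ℝ × ℝ) := fun i => {p | ∀ t, T₀ i.1 + i.2 ≤ t → |X p t - i.1| ≤ ρ i.1}
  have hF' : ∀ i, IsClosed (F i) ∧ interior (F i) = ∅ := fun i => hF i.1 _ (by simp)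
  have hd : Dense (⋂ i, (F i)ᶜ) := dense_iInter_of_isOpen (fun i => (hF' i).1.isOpen_compl)
    fun i => interior_eq_empty_iff_dense_compl.1 (hF' i).2
  refine hd.mono fun p hp => ?_
  rw [mem_dataConvergingToLocalMin_iff h hT hX hV]
  obtain ⟨c, hc, hcl, -⟩ := (hT p).exists_tendsto h ha hlow hinj hconv
  rcases hconv c hc with hcv | hcc
  · exact ⟨c, hcv.isLocalMin hc, hcl⟩
  · have hcS : c ∈ S := ⟨hc, hcc⟩
    have hclose : ∀ᶠ t in atTop, |X p t - c| < ρ ⟨c, hcS⟩ := by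
      simpa [Real.dist_eq] using hcl.eventually (Metric.ball_mem_nhds c (hρ ⟨c, hcS⟩))
    obtain ⟨T, hTc⟩ := eventually_atTop.1 hclose
    obtain ⟨n, hn⟩ := exists_nat_ge (T - T₀ ⟨c, hcS⟩)
    refine absurd ?_ (mem_iInter.1 hp (⟨c, hcS⟩, n))
    exact fun t ht => (hTc t (by simp only at ht; linarith)).le

end Genericity

theorem mainTheorem2 (a G : ℝ → ℝ)
    (ha_nonneg : ∀ t, 0 ≤ t → 0 ≤ a t)
    (ha_diff : DifferentiableOn ℝ a (Ici 0))
    (ha_anti : AntitoneOn a (Ici 0))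
    (ha_lim : Tendsto a atTop (𝓝 0))
    (ha_lower : ∃ c > 0, ∀ t, 0 ≤ t → c / (t + 1) ≤ a t)
    (hG_C1 : ContDiff ℝ 1 G)
    (hG_coercive : Tendsto G (cocompact ℝ) atTop)
    (hG_lip : ∀ s : Set ℝ, Bornology.IsBounded s → ∃ K, LipschitzOnWith K (deriv G) s)
    (hG_finite : {c | deriv G c = 0}.Finite)
    (hG_inj : InjOn G {c | deriv G c = 0})
    (hG_conv : ∀ c, deriv G c = 0 → StronglyConvexNear G c ∨ StronglyConcaveNear G c) :
    (∀ p : ℝ × ℝ, ∃ x, IsSolutionFrom a G p x ∧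
      ∀ y, IsSolutionFrom a G p y → EqOn y x (Ici 0)) ∧
    IsOpen (dataConvergingToLocalMin a G) ∧
    Dense (dataConvergingToLocalMin a G) := by
  have h : DampedSystem a G :=
    ⟨ha_nonneg, ha_diff.continuousOn, ha_anti, hG_C1, hG_coercive, hG_lip⟩
  choose X V hT hX hV using h.exists_isTraj
  refine ⟨fun p => ⟨X p, by simpa [hX, hV] using (hT p).isSolutionFrom h, fun y hy t ht => ?_⟩,
    isOpen_dataConvergingToLocalMin h ha_lim ha_lower hG_inj hG_conv hT hX hV,
    dense_dataConvergingToLocalMin h ha_lim ha_lower hG_finite hG_inj hG_conv hT hX hV⟩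
  exact (hy.isTraj.eq_of_initial_eq h (hT p) (by rw [hy.initial_position, hX])
    (by rw [hy.initial_velocity, hV]) ht).1
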